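/- Let $(\Omega,\mathcal F,\mathbb P)$ be a probability space and $\mathcal G\subseteq\mathcal F$ a sub-$\sigma$-algebra such that $(\Omega,\mathcal G,\mathbb P)$ is atomless, i.e. $\{\mathbb P(A): A\subseteq B,\ A\in\mathcal G\}=[0,\mathbb P(B)]$ for all $B\in\mathcal G$. Random variables are identified when $\mathbb P$-a.s. equal; $L^\infty$ denotes the essentially bounded ones, $L^0(\mathcal G)$ and $L^\infty(\mathcal G)$ the $\mathcal G$-measurable ones in $L^0$ and $L^\infty$, and $\overset{d}{=}$ equality in distribution under $\mathbb P$. A map $\rho:L^\infty\to\mathbb R$ is *coherent* if for all $X,Y\in L^\infty$: $\rho(X+c)=\rho(X)+c$ for $c\in\mathbb R$; $\rho(X)\le\rho(Y)$ whenever $X\le Y$; $\rho(\lambda X+(1-\lambda)Y)\le\lambda\rho(X)+(1-\lambda)\rho(Y)$ for $\lambda\in[0,1]$; and $\rho(\lambda X)=\lambda\rho(X)$ for $\lambda\ge0$. It is *Fatou continuous* if $\rho(X)\le\liminf_n\rho(X_n)$ for every uniformly bounded sequence $(X_n)$ in $L^\infty$ converging $\mathbb P$-a.s. to $X\in L^\infty$.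 It is *$\mathcal G$-law invariant* if $\rho(X)=\rho(Y)$ for all $X,Y\in L^\infty(\mathcal G)$ with $X\overset{d}{=}Y$. Let $\mathcal M(\mathcal G)$ (resp. $\mathcal M_1(\mathcal G)$) be the set of finite signed (resp. probability) measures on $(\Omega,\mathcal G)$ absolutely continuous with respect to $\mathbb P|_{\mathcal G}$; for $\mu\in\mathcal M(\mathcal G)$ let $D_\mu=d\mu/d\mathbb P|_{\mathcal G}$ and $\mathbb E^\mu[X]=\mathbb E[D_\mu X]$ for $X\in L^\infty$. Write $\mathcal M=\mathcal M(\mathcal F)$, $\mathcal M_1=\mathcal M_1(\mathcal F)$, and $\mathcal S^{\mathcal G}=\{\mu|_{\mathcal G}:\mu\in\mathcal S\}$ for $\mathcal S\subseteq\mathcal M$. The weak topology $w(\mathcal M(\mathcal G),L^\infty(\mathcal G))$ is the coarsest topology on $\mathcal M(\mathcal G)$ making $\mu\mapsto\mathbb E^\mu[X]$ continuous for every $X\in L^\infty(\mathcal G)$. A set $\mathcal C\subseteq\mathcal M(\mathcal G)$ is *$\mathcal G$-law invariant* if, whenever $\mu\in\mathcal C$, $Y\in L^0(\mathcal G)$ and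 $Y\overset{d}{=}D_\mu$, there is $\nu\in\mathcal C$ with $Y=D_\nu$ a.s. The *supporting set* of $\rho$ is $\mathcal S_\rho=\{\mu\in\mathcal M_1:\mathbb E^\mu[X]\le\rho(X)\text{ for all }X\in L^\infty\}$. **Theorem.** For every map $\rho:L^\infty\to\mathbb R$ the following are equivalent: (i) $\rho$ is Fatou continuous, $\mathcal G$-law invariant and coherent; (ii) there is a convex set $\mathcal S\subseteq\mathcal M_1$ such that the $w(\mathcal M(\mathcal G),L^\infty(\mathcal G))$-closure of $\mathcal S^{\mathcal G}$ is $\mathcal G$-law invariant and $\rho(X)=\sup_{\mu\in\mathcal S}\mathbb E^\mu[X]$ for all $X\in L^\infty$; (iii) $\rho$ is Fatou continuous and coherent, and the $w(\mathcal M(\mathcal G),L^\infty(\mathcal G))$-closure of $(\mathcal S_\rho)^{\mathcal G}$ is $\mathcal G$-law invariant. -/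

import Mathlib

open MeasureTheory ProbabilityTheory Filter Topology
open scoped ENNReal

noncomputable section

namespace PartialLaw

/-- `L^∞ = L^∞(Ω, ℱ, P)`: essentially bounded random variables up to `P`-a.s. equality. -/
abbrev LInf {Ω : Type*} {mΩ : MeasurableSpace Ω} (P : Measure Ω) : Type _ := Lp ℝ ∞ P

/-- `L^∞(𝒢)`: the elements of `L^∞` that have a `𝒢`-measurable representative. -/
abbrev LInfSub {Ω : Type*} (m : MeasurableSpace Ω) {mΩ : MeasurableSpace Ω} (P : Measure Ω) :
    Submodule ℝ (LInf P) := lpMeas ℝ ℝ m ∞ P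

/-- `(Ω, 𝒢, P)` is atomless: `{P(A) : A ⊆ B, A ∈ 𝒢} = [0, P(B)]` for every `B ∈ 𝒢`. -/
def Atomless {Ω : Type*} (m : MeasurableSpace Ω) {mΩ : MeasurableSpace Ω} (P : Measure Ω) :
    Prop :=
  ∀ B : Set Ω, MeasurableSet[m] B →
    {p : ℝ≥0∞ | ∃ A : Set Ω, A ⊆ B ∧ MeasurableSet[m] A ∧ P A = p} = Set.Icc 0 (P B)

/-! ### Properties of risk measures -/

/-- Coherent risk measures on `L^∞` (positive values are losses). -/
structure IsCoherent {Ω : Type*} {mΩ : MeasurableSpace Ω} {P : Measure Ω} [IsFiniteMeasure P]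
    (ρ : LInf P → ℝ) : Prop where
  cash_invariant : ∀ (X : LInf P) (c : ℝ), ρ (X + Lp.const ∞ P c) = ρ X + c
  monotone : ∀ X Y : LInf P, X ≤ Y → ρ X ≤ ρ Y
  convex : ∀ (X Y : LInf P) (t : ℝ), 0 ≤ t → t ≤ 1 →
    ρ (t • X + (1 - t) • Y) ≤ t * ρ X + (1 - t) * ρ Y
  pos_homogeneous : ∀ (X : LInf P) (t : ℝ), 0 ≤ t → ρ (t • X) = t * ρ X

/-- Fatou continuity. The lower limit is taken in the extended reals. -/
def IsFatou {Ω : Type*} {mΩ : MeasurableSpace Ω} {P : Measure Ω} (ρ : LInf P → ℝ) : Prop :=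
  ∀ (X : LInf P) (Xn : ℕ → LInf P), (∃ C : ℝ, ∀ n, ‖Xn n‖ ≤ C) →
    (∀ᵐ ω ∂P, Tendsto (fun n => Xn n ω) atTop (𝓝 (X ω))) →
    (ρ X : EReal) ≤ liminf (fun n => (ρ (Xn n) : EReal)) atTop

/-- `𝒢`-law invariance of `ρ : L^∞ → ℝ`. -/
def IsLawInvariant {Ω : Type*} (m : MeasurableSpace Ω) {mΩ : MeasurableSpace Ω}
    {P : Measure Ω} (ρ : LInf P → ℝ) : Prop :=
  ∀ X ∈ LInfSub m P, ∀ Y ∈ LInfSub m P, IdentDistrib X Y P P → ρ X = ρ Y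

/-- `𝒢`-law invariance of a set `𝒳 ⊆ L^0` of random variables. -/
def IsLawInvariantSet {Ω : Type*} (m : MeasurableSpace Ω) {mΩ : MeasurableSpace Ω}
    {P : Measure Ω} (𝒳 : Set (Ω →ₘ[P] ℝ)) : Prop :=
  ∀ X ∈ 𝒳, AEStronglyMeasurable[m] X P →
    ∀ Y : Ω →ₘ[P] ℝ, AEStronglyMeasurable[m] Y P → IdentDistrib X Y P P → Y ∈ 𝒳

/-! ### Spaces of measures -/

/-- `ℳ(𝒢)`: finite signed measures on `(Ω, 𝒢)` that are absolutely continuous with respect to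
`P|_𝒢`. The case `ℳ = ℳ(ℱ)` is obtained from `hm = le_rfl`. -/
def SMeas {Ω : Type*} {m mΩ : MeasurableSpace Ω} (hm : m ≤ mΩ) (P : Measure Ω) :
    Submodule ℝ (@SignedMeasure Ω m) where
  carrier := {μ | μ ≪ᵥ (P.trim hm).toENNRealVectorMeasure}
  add_mem' h₁ h₂ := h₁.add h₂
  zero_mem' := VectorMeasure.AbsolutelyContinuous.zero _
  smul_mem' c μ h := fun A hA => by
    have h0 : μ A = 0 := h hA
    simp [h0]

/-- `ℳ₁(𝒢)`: the probability measures in `ℳ(𝒢)`. -/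
def PMeas {Ω : Type*} {m mΩ : MeasurableSpace Ω} (hm : m ≤ mΩ) (P : Measure Ω) :
    Set (SMeas hm P) :=
  {μ | (∀ A : Set Ω, MeasurableSet[m] A → 0 ≤ μ.1 A) ∧ μ.1 Set.univ = 1}

/-- The density `D_μ = dμ / d(P|_𝒢)`. -/
def density {Ω : Type*} {m mΩ : MeasurableSpace Ω} {hm : m ≤ mΩ} {P : Measure Ω}
    (μ : SMeas hm P) : Ω → ℝ :=
  SignedMeasure.rnDeriv μ.1 (P.trim hm)

/-- `E^μ[X] = E[D_μ X]` for `μ ∈ ℳ(𝒢)` and `X ∈ L^∞`. -/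
def expect {Ω : Type*} {m mΩ : MeasurableSpace Ω} {hm : m ≤ mΩ} {P : Measure Ω}
    (μ : SMeas hm P) (X : LInf P) : ℝ :=
  ∫ ω, density μ ω * X ω ∂P

/-- The set of densities `{D_μ : μ ∈ 𝒮}`, as a subset of `L^0`. -/
def densities {Ω : Type*} {m mΩ : MeasurableSpace Ω} {hm : m ≤ mΩ} {P : Measure Ω}
    (S : Set (SMeas hm P)) : Set (Ω →ₘ[P] ℝ) :=
  {f | ∃ μ ∈ S, f =ᵐ[P] density μ}

/-- The restriction `μ|_𝒢 ∈ ℳ(𝒢)` of `μ ∈ ℳ`. -/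
def restrictTo {Ω : Type*} {m mΩ : MeasurableSpace Ω} (hm : m ≤ mΩ) {P : Measure Ω}
    (μ : SMeas (le_refl mΩ) P) : SMeas hm P :=
  ⟨VectorMeasure.trim μ.1 hm, by
    refine @VectorMeasure.AbsolutelyContinuous.mk Ω m ℝ _ _ _ _ _ _ _ ?_
    intro A hA h0
    rw [Measure.toENNRealVectorMeasure_apply_measurable hA, trim_measurableSet_eq hm hA] at h0
    rw [VectorMeasure.trim_measurableSet_eq hm hA]
    refine μ.2 ?_
    rw [Measure.toENNRealVectorMeasure_apply_measurable (hm A hA), trim_eq_self, h0]⟩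

/-- The weak topology `w(ℳ(𝒢), L^∞(𝒢))`: the coarsest topology on `ℳ(𝒢)` that makes
`μ ↦ E^μ[X]` continuous for every `X ∈ L^∞(𝒢)`. -/
abbrev weakTopology {Ω : Type*} {m mΩ : MeasurableSpace Ω} (hm : m ≤ mΩ) (P : Measure Ω) :
    TopologicalSpace (SMeas hm P) :=
  TopologicalSpace.induced (fun μ (X : LInfSub m P) => expect μ X.1) inferInstance

/-- For `𝒮 ⊆ ℳ`: the `w(ℳ(𝒢), L^∞(𝒢))`-closure of `𝒮^𝒢 = {μ|_𝒢 : μ ∈ 𝒮}`. -/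
def restrictClosure {Ω : Type*} {m mΩ : MeasurableSpace Ω} (hm : m ≤ mΩ) {P : Measure Ω}
    (S : Set (SMeas (le_refl mΩ) P)) : Set (SMeas hm P) :=
  @closure _ (weakTopology hm P) (restrictTo hm '' S)

/-- The supporting set `𝒮_ρ = {μ ∈ ℳ₁ : E^μ[X] ≤ ρ(X) for all X ∈ L^∞}`. -/
def supportingSet {Ω : Type*} {mΩ : MeasurableSpace Ω} {P : Measure Ω} (ρ : LInf P → ℝ) :
    Set (SMeas (le_refl mΩ) P) :=
  {μ | μ ∈ PMeas (le_refl mΩ) P ∧ ∀ X : LInf P, expect μ X ≤ ρ X}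

end PartialLaw

end

open PartialLaw

/-!
The equivalence rests on three facts.

*Representation.* A Fatou continuous coherent `ρ` is the supremum of the expectations under its
supporting set (`isLUB_supportingSet`). By cash invariance it suffices to find, for `ρ X > 0`, a
measure `μ` in the supporting set with `E^μ[X] ≥ 0`. Instead of the Krein–Šmulian theorem the proof
constructs a convex set `W` of nonnegative `v` on which `ρ (X - v)` stays positive. It is given by
bounds `ε n` on the expected excesses `E[(v - n)⁺]`, and these bounds are chosen one after another
(`exists_excess_bound`): if no choice worked, points of almost minimal `L²` norm in a decreasing
sequence of convex sets of counterexamples would converge almost surely (along a subsequence) to a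
forbidden limit, against Fatou continuity. A linear functional `ℓ ≤ ρ` with `ℓ (X - v) ≥ 0` on `W`
exists by the Mazur–Orlicz theorem, and since `W` contains `n 1_B` as soon as `P(B)` is small, `ℓ`
is countably additive and absolutely continuous.

*Closure.* If `ρ` is the supremum of the expectations under a convex set `𝒮`, then by Hahn–Banach
the weak closure of `𝒮^𝒢` consists of the `ν` with `E^ν[X] ≤ ρ(X)` for all `X ∈ L^∞(𝒢)`
(`mem_restrictClosure_iff`).

*Rearrangement.* On an atomless space, if `V` and `V'` have the same law, then for each `W` there
are `W'` with the law of `W` for which `E[V' W']` is not less than `E[V W] - ε`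
(`exists_rearrangement`). After rounding, `V` and `V'` have countably many values, and copies of `W`
can be placed on their level sets one by one. Applied with `W` a density, this passes from law
invariance of the closure to law invariance of `ρ`; applied with `W ∈ L^∞(𝒢)` and `V` a density, it
gives the converse.
-/

namespace PartialLaw

/-! ### Densities and expectations -/

section Densities

variable {Ω : Type*} {m mΩ : MeasurableSpace Ω} {hm : m ≤ mΩ} {P : Measure Ω}

lemma stronglyMeasurable_density (μ : SMeas hm P) : StronglyMeasurable[m] (density μ) :=
  Measurable.stronglyMeasurable (SignedMeasure.measurable_rnDeriv _ _)

lemma integrable_density (μ : SMeas hm P) : Integrable (density μ) P :=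
  integrable_of_integrable_trim hm (SignedMeasure.integrable_rnDeriv _ _)

variable [IsFiniteMeasure P]

lemma setIntegral_density (μ : SMeas hm P) {A : Set Ω} (hA : MeasurableSet[m] A) :
    ∫ ω in A, density μ ω ∂P = μ.1 A := by
  have h := SignedMeasure.withDensityᵥ_rnDeriv_eq μ.1 (P.trim hm) μ.2
  conv_rhs => rw [← h]
  rw [withDensityᵥ_apply (SignedMeasure.integrable_rnDeriv _ _) hA]
  rw [setIntegral_trim hm (stronglyMeasurable_density μ) hA]
  rfl

lemma ae_eq_density (μ : SMeas hm P) {f : Ω → ℝ} (hf : Integrable f P)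
    (hfm : AEStronglyMeasurable[m] f P)
    (h : ∀ A, MeasurableSet[m] A → ∫ ω in A, f ω ∂P = μ.1 A) : f =ᵐ[P] density μ := by
  refine ae_eq_of_forall_setIntegral_eq_of_sigmaFinite' hm
    (fun s _ _ => hf.integrableOn) (fun s _ _ => (integrable_density μ).integrableOn) ?_ hfm
    (stronglyMeasurable_density μ).aestronglyMeasurable
  intro s hs _
  rw [h s hs, setIntegral_density μ hs]

lemma density_add (μ ν : SMeas hm P) : density (μ + ν) =ᵐ[P] density μ + density ν := by
  refine (ae_eq_density _ ((integrable_density μ).add (integrable_density ν))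
    ((stronglyMeasurable_density μ).add (stronglyMeasurable_density ν)).aestronglyMeasurable
    fun A hA => ?_).symm
  rw [integral_add' (integrable_density μ).integrableOn (integrable_density ν).integrableOn,
    setIntegral_density μ hA, setIntegral_density ν hA]
  rfl

lemma density_smul (c : ℝ) (μ : SMeas hm P) : density (c • μ) =ᵐ[P] c • density μ := by
  refine (ae_eq_density _ ((integrable_density μ).smul c)
    ((stronglyMeasurable_density μ).const_smul c).aestronglyMeasurable fun A hA => ?_).symm
  simp only [Pi.smul_apply]
  rw [integral_smul, setIntegral_density μ hA]
  rfl

/-- Every integrable `𝒢`-measurable function is the density of a measure in `ℳ(𝒢)`. -/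
lemma exists_density_eq (hm : m ≤ mΩ) {f : Ω → ℝ} (hf : Integrable f P)
    (hfm : AEStronglyMeasurable[m] f P) : ∃ μ : SMeas hm P, f =ᵐ[P] density μ := by
  refine ⟨⟨(P.withDensityᵥ f).trim hm, hf.withDensityᵥ_trim_absolutelyContinuous hm⟩,
    ae_eq_density _ hf hfm fun A hA => ?_⟩
  exact (hf.withDensityᵥ_trim_eq_integral hm hA).symm

lemma density_nonneg {μ : SMeas hm P} (h : μ ∈ PMeas hm P) : 0 ≤ᵐ[P] density μ := by
  refine ae_of_ae_trim hm (ae_nonneg_of_forall_setIntegral_nonneg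
    (SignedMeasure.integrable_rnDeriv _ _) fun s hs _ => ?_)
  have := setIntegral_density μ hs
  rw [← setIntegral_trim hm (stronglyMeasurable_density μ) hs]
  exact (setIntegral_density μ hs).symm ▸ h.1 s hs

lemma integral_density {μ : SMeas hm P} (h : μ ∈ PMeas hm P) : ∫ ω, density μ ω ∂P = 1 := by
  rw [← setIntegral_univ, setIntegral_density μ MeasurableSet.univ, h.2]

end Densities

section Expectation

variable {Ω : Type*} {m mΩ : MeasurableSpace Ω} {hm : m ≤ mΩ} {P : Measure Ω}

lemma ae_abs_le_norm (X : LInf P) : ∀ᵐ ω ∂P, |X ω| ≤ ‖X‖ := by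
  have h := Lp.norm_def X
  filter_upwards [ae_le_eLpNormEssSup (f := X) (μ := P)] with ω hω
  have h2 : eLpNormEssSup X P ≠ ∞ := by
    have := Lp.eLpNorm_ne_top X
    rwa [eLpNorm_exponent_top] at this
  rw [h, eLpNorm_exponent_top, ← Real.norm_eq_abs, ← toReal_enorm]
  exact ENNReal.toReal_mono h2 hω

lemma norm_le_of_ae_abs_le {X : LInf P} {C : ℝ} (hC : 0 ≤ C) (h : ∀ᵐ ω ∂P, |X ω| ≤ C) :
    ‖X‖ ≤ C := by
  rw [Lp.norm_def, eLpNorm_exponent_top]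
  refine ENNReal.toReal_le_of_le_ofReal hC (eLpNormEssSup_le_of_ae_bound (by simpa using h))

lemma integrable_mul_of_integrable {f : Ω → ℝ} (hf : Integrable f P) (X : LInf P) :
    Integrable (fun ω => f ω * X ω) P :=
  hf.mul_bdd (c := ‖X‖) (Lp.aestronglyMeasurable X) (by simpa using ae_abs_le_norm X)

lemma integrable_density_mul (μ : SMeas hm P) (X : LInf P) :
    Integrable (fun ω => density μ ω * X ω) P :=
  integrable_mul_of_integrable (integrable_density μ) X

lemma expect_add_right (μ : SMeas hm P) (X Y : LInf P) :
    expect μ (X + Y) = expect μ X + expect μ Y := by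
  unfold expect
  rw [← integral_add (integrable_density_mul μ X) (integrable_density_mul μ Y)]
  refine integral_congr_ae ?_
  filter_upwards [Lp.coeFn_add X Y] with ω h
  rw [h, Pi.add_apply, mul_add]

lemma expect_smul_right (μ : SMeas hm P) (c : ℝ) (X : LInf P) :
    expect μ (c • X) = c * expect μ X := by
  unfold expect
  rw [← integral_const_mul]
  refine integral_congr_ae ?_
  filter_upwards [Lp.coeFn_smul c X] with ω h
  rw [h, Pi.smul_apply, smul_eq_mul]
  ring

variable [IsFiniteMeasure P]

lemma expect_add_left (μ ν : SMeas hm P) (X : LInf P) :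
    expect (μ + ν) X = expect μ X + expect ν X := by
  unfold expect
  rw [← integral_add (integrable_density_mul μ X) (integrable_density_mul ν X)]
  refine integral_congr_ae ?_
  filter_upwards [density_add μ ν] with ω h
  rw [h, Pi.add_apply, add_mul]

lemma expect_smul_left (c : ℝ) (μ : SMeas hm P) (X : LInf P) :
    expect (c • μ) X = c * expect μ X := by
  unfold expect
  rw [← integral_const_mul]
  refine integral_congr_ae ?_
  filter_upwards [density_smul c μ] with ω h
  rw [h, Pi.smul_apply, smul_eq_mul, mul_assoc]

lemma expect_mono {μ : SMeas hm P} (hμ : μ ∈ PMeas hm P) {X Y : LInf P} (h : X ≤ Y) :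
    expect μ X ≤ expect μ Y := by
  refine integral_mono_ae (integrable_density_mul μ X) (integrable_density_mul μ Y) ?_
  filter_upwards [density_nonneg hμ, (Lp.coeFn_le X Y).2 h] with ω h1 h2
  exact mul_le_mul_of_nonneg_left h2 h1

lemma expect_const {μ : SMeas hm P} (hμ : μ ∈ PMeas hm P) (c : ℝ) :
    expect μ (Lp.const ∞ P c) = c := by
  have : expect μ (Lp.const ∞ P c) = ∫ ω, density μ ω * c ∂P := by
    refine integral_congr_ae ?_
    filter_upwards [Lp.coeFn_const ∞ P c] with ω h
    rw [h, Function.const_apply]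
  rw [this, integral_mul_const, integral_density hμ, one_mul]

/-- Restriction to `𝒢` takes the conditional expectation of the density. -/
lemma density_restrictTo (hm : m ≤ mΩ) (μ : SMeas (le_refl mΩ) P) :
    density (restrictTo hm μ) =ᵐ[P] P[density μ | m] := by
  refine (ae_eq_density _ integrable_condExp
    stronglyMeasurable_condExp.aestronglyMeasurable fun A hA => ?_).symm
  rw [setIntegral_condExp hm (integrable_density μ) hA, setIntegral_density μ (hm A hA)]
  exact (VectorMeasure.trim_measurableSet_eq hm hA).symm

lemma expect_restrictTo (hm : m ≤ mΩ) (μ : SMeas (le_refl mΩ) P) {X : LInf P}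
    (hX : X ∈ LInfSub m P) : expect (restrictTo hm μ) X = expect μ X := by
  have h : condExp m P (density μ * (X : Ω → ℝ)) =ᵐ[P] condExp m P (density μ) * (X : Ω → ℝ) :=
    condExp_mul_of_aestronglyMeasurable_right
    (mem_lpMeas_iff_aestronglyMeasurable.1 hX) (integrable_density_mul μ X) (integrable_density μ)
  unfold expect
  calc ∫ ω, density (restrictTo hm μ) ω * X ω ∂P
      = ∫ ω, condExp m P (density μ * (X : Ω → ℝ)) ω ∂P := by
        refine integral_congr_ae ?_
        filter_upwards [density_restrictTo hm μ, h] with ω h1 h2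
        rw [h1, h2, Pi.mul_apply]
    _ = _ := integral_condExp hm

end Expectation

/-! ### Copies of random variables on atomless spaces -/

section Atomless

variable {Ω : Type*} {mΩ : MeasurableSpace Ω}

/-- A set between `A ⊆ B` whose measure is the mean of those of `A` and `B`. -/
lemma exists_between_measure_eq_half {Q : Measure Ω} [IsFiniteMeasure Q]
    (hQ : ∀ B, MeasurableSet B → ∀ c ≤ Q B, ∃ A ⊆ B, MeasurableSet A ∧ Q A = c)
    {A B : Set Ω} (hA : MeasurableSet A) (hB : MeasurableSet B) (hAB : A ⊆ B) :
    ∃ C, MeasurableSet C ∧ A ⊆ C ∧ C ⊆ B ∧ Q.real C = (Q.real A + Q.real B) / 2 := by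
  obtain ⟨D, hD, hDm, hDQ⟩ := hQ (B \ A) (hB.diff hA) (Q (B \ A) / 2) ENNReal.half_le_self
  refine ⟨A ∪ D, hA.union hDm, Set.subset_union_left,
    Set.union_subset hAB (hD.trans Set.sdiff_subset), ?_⟩
  rw [measureReal_union (Set.disjoint_left.2 fun x hxA hxD => (hD hxD).2 hxA) hDm]
  have h1 : Q.real D = Q.real (B \ A) / 2 := by simp [measureReal_def, hDQ]
  rw [h1, measureReal_sdiff hAB hA]
  ring

/-- An increasing family of sets indexed by the dyadic rationals `k / 2 ^ n` of `[0, 1]`, the set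
with index `k / 2 ^ n` having probability `k / 2 ^ n`. -/
lemma exists_dyadic_chain {Q : Measure Ω} [IsProbabilityMeasure Q]
    (hQ : ∀ B, MeasurableSet B → ∀ c ≤ Q B, ∃ A ⊆ B, MeasurableSet A ∧ Q A = c) :
    ∃ g : ℕ → ℕ → Set Ω, (∀ n k, MeasurableSet (g n k)) ∧
      (∀ n k, k ≤ 2 ^ n → Q.real (g n k) = k / 2 ^ n) ∧
      ∀ n j l k, j * 2 ^ l ≤ k * 2 ^ n → g n j ⊆ g l k := by
  have H : ∀ A B : Set Ω, ∃ C, MeasurableSet A → MeasurableSet B → A ⊆ B →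
      MeasurableSet C ∧ A ⊆ C ∧ C ⊆ B ∧ Q.real C = (Q.real A + Q.real B) / 2 := by
    intro A B
    by_cases h : MeasurableSet A ∧ MeasurableSet B ∧ A ⊆ B
    · obtain ⟨C, hC⟩ := exists_between_measure_eq_half hQ h.1 h.2.1 h.2.2
      exact ⟨C, fun _ _ _ => hC⟩
    · exact ⟨∅, fun h1 h2 h3 => absurd ⟨h1, h2, h3⟩ h⟩
  choose mid hmid using H
  obtain ⟨g, hg0, hg⟩ : ∃ g : ℕ → ℕ → Set Ω, (g 0 = fun k => if k = 0 then ∅ else Set.univ) ∧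
      ∀ n, g (n + 1) = fun k =>
        if k % 2 = 0 then g n (k / 2) else mid (g n (k / 2)) (g n (k / 2 + 1)) :=
    ⟨fun n => Nat.rec (fun k => if k = 0 then ∅ else Set.univ) (fun _ f k =>
      if k % 2 = 0 then f (k / 2) else mid (f (k / 2)) (f (k / 2 + 1))) n, rfl, fun _ => rfl⟩
  have inv : ∀ n, (∀ k, MeasurableSet (g n k)) ∧ (∀ k, g n k ⊆ g n (k + 1)) := by
    intro n
    induction n with
    | zero =>
      rw [hg0]
      refine ⟨fun k => ?_, fun k => ?_⟩
      · dsimp only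
        split_ifs
        exacts [MeasurableSet.empty, MeasurableSet.univ]
      · simp
    | succ n ih =>
      have hm := fun k => hmid _ _ (ih.1 k) (ih.1 (k + 1)) (ih.2 k)
      rw [hg]
      refine ⟨fun k => ?_, fun k => ?_⟩
      · dsimp only
        split_ifs
        exacts [ih.1 _, (hm _).1]
      · dsimp only
        rcases Nat.even_or_odd' k with ⟨j, rfl | rfl⟩
        · rw [if_pos (by omega), if_neg (by omega), show 2 * j / 2 = j by omega,
            show (2 * j + 1) / 2 = j by omega]
          exact (hm j).2.1
        · rw [if_neg (by omega), if_pos (by omega), show (2 * j + 1) / 2 = j by omega,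
            show (2 * j + 1 + 1) / 2 = j + 1 by omega]
          exact (hm j).2.2.1
  have mono : ∀ n, Monotone (g n) := fun n => monotone_nat_of_le_succ (inv n).2
  have refine_eq : ∀ l n k, g (n + l) (k * 2 ^ l) = g n k := by
    intro l
    induction l with
    | zero => simp
    | succ l ih =>
      intro n k
      rw [← add_assoc, hg]
      dsimp only
      rw [show k * 2 ^ (l + 1) = 2 * (k * 2 ^ l) by ring, if_pos (by omega),
        Nat.mul_div_cancel_left _ two_pos, ih]
  refine ⟨g, fun n => (inv n).1, fun n => ?_, fun n j l k h => ?_⟩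
  · induction n with
    | zero =>
      intro k hk
      rw [hg0]
      dsimp only
      have : k = 0 ∨ k = 1 := by simp at hk; omega
      rcases this with rfl | rfl <;> simp
    | succ n ih =>
      intro k hk
      rw [pow_succ] at hk
      rw [hg]
      dsimp only
      rcases Nat.even_or_odd' k with ⟨j, rfl | rfl⟩
      · rw [if_pos (by omega), show 2 * j / 2 = j by omega, ih j (by omega)]
        push_cast
        field_simp
        ring
      · rw [if_neg (by omega), show (2 * j + 1) / 2 = j by omega,
          (hmid _ _ ((inv n).1 j) ((inv n).1 (j + 1)) ((inv n).2 j)).2.2.2,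
          ih j (by omega), ih (j + 1) (by omega)]
        push_cast
        field_simp
        ring
  · rw [← refine_eq l n j, ← refine_eq n l k, add_comm l n]
    exact mono _ h

open unitInterval in
/-- The infimum of the indices of the sets of a dyadic chain that contain `ω` is uniformly
distributed. It is encoded as the supremum of the indices of the sets that do not contain `ω`. -/
lemma exists_uniform {Q : Measure Ω} [IsProbabilityMeasure Q]
    (hQ : ∀ B, MeasurableSet B → ∀ c ≤ Q B, ∃ A ⊆ B, MeasurableSet A ∧ Q A = c) :
    ∃ U : Ω → I, Measurable U ∧ Q.map U = volume := by
  obtain ⟨g, gm, gQ, gmono⟩ := exists_dyadic_chain hQ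
  let U : Ω → I := fun ω => sSup {x | ∃ n k : ℕ, (x : ℝ) = k / 2 ^ n ∧ ω ∉ g n k}
  have hU : ∀ a ω, U ω ≤ a ↔ ∀ n k : ℕ, k ≤ 2 ^ n → (a : ℝ) < k / 2 ^ n → ω ∈ g n k := by
    intro a ω
    simp only [U, sSup_le_iff, Set.mem_ofPred_eq]
    constructor
    · intro h n k hk hak
      by_contra hω
      refine absurd (h ⟨k / 2 ^ n, by positivity, ?_⟩ ⟨n, k, rfl, hω⟩) (not_le.2 hak)
      rw [div_le_one (by positivity)]
      exact_mod_cast hk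
    · rintro h b ⟨n, k, hb, hω⟩
      by_contra! hab
      refine hω (h n k ?_ (hb ▸ hab))
      have := hb ▸ b.2.2
      rw [div_le_one (by positivity)] at this
      exact_mod_cast this
  have hUm : Measurable U := by
    refine measurable_of_Iic fun a => ?_
    have : U ⁻¹' Set.Iic a = ⋂ (n : ℕ) (k : ℕ) (_ : k ≤ 2 ^ n) (_ : (a : ℝ) < k / 2 ^ n), g n k := by
      ext ω
      simp only [Set.mem_preimage, Set.mem_Iic, hU, Set.mem_iInter]
    rw [this]
    exact .iInter fun n => .iInter fun k => .iInter fun _ => .iInter fun _ => gm n k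
  refine ⟨U, hUm, Measure.ext_of_Iic _ _ fun a => ?_⟩
  rw [Measure.map_apply hUm measurableSet_Iic, unitInterval.volume_Iic,
    ← ENNReal.ofReal_toReal (measure_ne_top Q _)]
  congr 1
  change Q.real _ = _
  have ha0 : (0 : ℝ) ≤ a := a.2.1
  have lower : ∀ n : ℕ, (a : ℝ) - (1 / 2) ^ n ≤ Q.real (U ⁻¹' Set.Iic a) := by
    intro n
    have h2 : (0 : ℝ) < 2 ^ n := by positivity
    have hfl := Nat.floor_le (mul_nonneg ha0 h2.le)
    have hk : ⌊(a : ℝ) * 2 ^ n⌋₊ ≤ 2 ^ n := by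
      have : ((⌊(a : ℝ) * 2 ^ n⌋₊ : ℕ) : ℝ) ≤ 2 ^ n :=
        hfl.trans (mul_le_of_le_one_left h2.le a.2.2)
      exact_mod_cast this
    calc (a : ℝ) - (1 / 2) ^ n ≤ (⌊(a : ℝ) * 2 ^ n⌋₊ : ℕ) / 2 ^ n := by
          rw [le_div_iff₀ h2, sub_mul, ← mul_pow]
          norm_num
          exact (Nat.lt_floor_add_one _).le
      _ = Q.real (g n ⌊(a : ℝ) * 2 ^ n⌋₊) := (gQ n _ hk).symm
      _ ≤ _ := measureReal_mono fun ω hω => (hU a ω).2 fun l k _ hak => gmono n _ l k ?_ hω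
    have h2l : (0 : ℝ) < 2 ^ l := by positivity
    rw [lt_div_iff₀ h2l] at hak
    have : ((⌊(a : ℝ) * 2 ^ n⌋₊ : ℕ) : ℝ) * 2 ^ l ≤ k * 2 ^ n := by nlinarith
    exact_mod_cast this
  have upper : ∀ n : ℕ, Q.real (U ⁻¹' Set.Iic a) ≤ a + (1 / 2) ^ n := by
    intro n
    have h2 : (0 : ℝ) < 2 ^ n := by positivity
    have hfl := Nat.floor_le (mul_nonneg ha0 h2.le)
    by_cases hk : ⌊(a : ℝ) * 2 ^ n⌋₊ + 1 ≤ 2 ^ n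
    · calc Q.real (U ⁻¹' Set.Iic a) ≤ Q.real (g n (⌊(a : ℝ) * 2 ^ n⌋₊ + 1)) := by
            refine measureReal_mono fun ω hω => (hU a ω).1 hω n _ hk ?_
            rw [lt_div_iff₀ h2]
            exact_mod_cast Nat.lt_floor_add_one _
        _ = ((⌊(a : ℝ) * 2 ^ n⌋₊ + 1 : ℕ) : ℝ) / 2 ^ n := gQ n _ hk
        _ ≤ _ := by
            rw [div_le_iff₀ h2, add_mul, ← mul_pow]
            push_cast
            norm_num
            exact hfl
    · -- here `⌊a * 2 ^ n⌋ ≥ 2 ^ n`, so that `a = 1`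
      have h1 : ((2 ^ n : ℕ) : ℝ) ≤ (⌊(a : ℝ) * 2 ^ n⌋₊ : ℕ) := by
        exact_mod_cast (by omega : 2 ^ n ≤ ⌊(a : ℝ) * 2 ^ n⌋₊)
      push_cast at h1
      have h3 : (1 : ℝ) ≤ a := by nlinarith
      exact measureReal_le_one.trans (h3.trans (le_add_of_nonneg_right (by positivity)))
  have hlim : Tendsto (fun n : ℕ => ((1 : ℝ) / 2) ^ n) atTop (𝓝 0) :=
    tendsto_pow_atTop_nhds_zero_of_lt_one (by norm_num) (by norm_num)
  refine le_antisymm (ge_of_tendsto' (by simpa using hlim.const_add (a : ℝ)) upper)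
    (le_of_tendsto' (by simpa using hlim.const_sub (a : ℝ)) lower)

/-- An atomless finite measure carries every law of the same total mass. -/
lemma exists_map_eq {Q : Measure Ω} [IsFiniteMeasure Q]
    (hQ : ∀ B, MeasurableSet B → ∀ c ≤ Q B, ∃ A ⊆ B, MeasurableSet A ∧ Q A = c)
    {ν : Measure ℝ} (hν : ν Set.univ = Q Set.univ) :
    ∃ g : Ω → ℝ, Measurable g ∧ Q.map g = ν := by
  by_cases h0 : Q Set.univ = 0
  · refine ⟨fun _ => 0, measurable_const, ?_⟩
    rw [Measure.measure_univ_eq_zero.1 h0, Measure.map_zero]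
    exact (Measure.measure_univ_eq_zero.1 (hν.trans h0)).symm
  have hne : Q ≠ 0 := fun h => h0 (by simp [h])
  have htop : Q Set.univ ≠ ∞ := measure_ne_top Q _
  have : NeZero Q := ⟨hne⟩
  have : IsProbabilityMeasure ((Q Set.univ)⁻¹ • Q) :=
    ⟨by simp⟩
  have : IsProbabilityMeasure ((Q Set.univ)⁻¹ • ν) :=
    ⟨by simp [hν, ENNReal.inv_mul_cancel h0 htop]⟩
  obtain ⟨U, hUm, hU⟩ := exists_uniform (Q := (Q Set.univ)⁻¹ • Q) (by
    intro B hB c hc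
    simp only [Measure.smul_apply, smul_eq_mul] at hc ⊢
    obtain ⟨A, hAB, hA, hAc⟩ := hQ B hB (Q Set.univ * c) (by
      rwa [ENNReal.mul_le_iff_le_inv h0 htop])
    exact ⟨A, hAB, hA, by rw [hAc, ← mul_assoc, ENNReal.inv_mul_cancel h0 htop, one_mul]⟩)
  obtain ⟨f, hf, hfν⟩ := ((Q Set.univ)⁻¹ • ν).exists_measurable_map_eq
  refine ⟨f ∘ U, hf.comp hUm, ?_⟩
  rw [← Measure.map_map hf hUm]
  have hQU : Q.map U = Q Set.univ • volume := by
    rw [← hU, Measure.map_smul, smul_smul, ENNReal.mul_inv_cancel h0 htop, one_smul]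
  rw [hQU, Measure.map_smul, hfν, smul_smul, ENNReal.mul_inv_cancel h0 htop, one_smul]

end Atomless

section Rearrangement

variable {Ω : Type*} {mΩ : MeasurableSpace Ω}

/-- If `k` and `k'` have the same law and take countably many values, then every `W` has a copy
`W'` for which `(k', W')` is distributed as `(k, W)`: on each level set of `k'` one places a copy of
the restriction of `W` to the corresponding level set of `k`. -/
lemma exists_map_prodMk_eq {Q : Measure Ω} [IsFiniteMeasure Q]
    (hQ : ∀ B, MeasurableSet B → ∀ c ≤ Q B, ∃ A ⊆ B, MeasurableSet A ∧ Q A = c)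
    {k k' : Ω → ℤ} (hk : Measurable k) (hk' : Measurable k') (hkk : Q.map k = Q.map k')
    {W : Ω → ℝ} (hW : Measurable W) :
    ∃ W' : Ω → ℝ, Measurable W' ∧
      Q.map (fun ω => (k ω, W ω)) = Q.map (fun ω => (k' ω, W' ω)) := by
  have hs : ∀ i, MeasurableSet (k ⁻¹' {i}) := fun i => hk (measurableSet_singleton i)
  have hs' : ∀ i, MeasurableSet (k' ⁻¹' {i}) := fun i => hk' (measurableSet_singleton i)
  have H : ∀ i : ℤ, ∃ g : Ω → ℝ, Measurable g ∧
      (Q.restrict (k' ⁻¹' {i})).map g = (Q.restrict (k ⁻¹' {i})).map W := by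
    intro i
    refine exists_map_eq (fun B hB c hc => ?_) ?_
    · rw [Measure.restrict_apply hB] at hc
      obtain ⟨A, hAB, hA, hAc⟩ := hQ _ (hB.inter (hs' i)) c hc
      refine ⟨A, hAB.trans Set.inter_subset_left, hA, ?_⟩
      rw [Measure.restrict_apply hA,
        Set.inter_eq_self_of_subset_left (hAB.trans Set.inter_subset_right), hAc]
    · rw [Measure.map_apply hW MeasurableSet.univ, Set.preimage_univ, Measure.restrict_apply_univ,
        Measure.restrict_apply_univ, ← Measure.map_apply hk (measurableSet_singleton i), hkk,
        Measure.map_apply hk' (measurableSet_singleton i)]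
  choose g hg hgW using H
  have hW' : Measurable fun ω => g (k' ω) ω :=
    (measurable_from_prod_countable_right (f := fun p : ℤ × Ω => g p.1 p.2) hg).comp
      (hk'.prodMk measurable_id)
  refine ⟨fun ω => g (k' ω) ω, hW', Measure.ext fun s hsm => ?_⟩
  rw [Measure.map_apply (hk.prodMk hW) hsm, Measure.map_apply (hk'.prodMk hW') hsm]
  have decomp : ∀ (κ : Ω → ℤ), Measurable κ → ∀ E : Set Ω, MeasurableSet E →
      Q E = ∑' i, Q.restrict (κ ⁻¹' {i}) E := by
    intro κ hκ E hE
    have : Q E = Q (⋃ i, E ∩ κ ⁻¹' {i}) := by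
      congr 1
      ext ω
      simp
    rw [this, measure_iUnion]
    · simp only [Measure.restrict_apply hE]
    · intro i j hij
      refine Set.disjoint_left.2 fun ω h1 h2 => hij ?_
      rw [← h1.2, ← h2.2]
    · exact fun i => hE.inter (hκ (measurableSet_singleton i))
  rw [decomp k hk _ (hk.prodMk hW hsm), decomp k' hk' _ (hk'.prodMk hW' hsm)]
  refine tsum_congr fun i => ?_
  have hsi : MeasurableSet (Prod.mk i ⁻¹' s) := measurable_prodMk_left hsm
  have e1 : Q.restrict (k ⁻¹' {i}) ((fun ω => (k ω, W ω)) ⁻¹' s) =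
      (Q.restrict (k ⁻¹' {i})).map W (Prod.mk i ⁻¹' s) := by
    rw [Measure.map_apply hW hsi, Measure.restrict_apply (hk.prodMk hW hsm),
      Measure.restrict_apply (hW hsi)]
    congr 1
    ext ω
    simp only [Set.mem_inter_iff, Set.mem_preimage, Set.mem_singleton_iff]
    exact and_congr_left fun h => by rw [h]
  have e2 : Q.restrict (k' ⁻¹' {i}) ((fun ω => (k' ω, g (k' ω) ω)) ⁻¹' s) =
      (Q.restrict (k' ⁻¹' {i})).map (g i) (Prod.mk i ⁻¹' s) := by
    rw [Measure.map_apply (hg i) hsi, Measure.restrict_apply (hk'.prodMk hW' hsm),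
      Measure.restrict_apply (hg i hsi)]
    congr 1
    ext ω
    simp only [Set.mem_inter_iff, Set.mem_preimage, Set.mem_singleton_iff]
    exact and_congr_left fun h => by rw [h]
  rw [e1, e2, hgW]

lemma exists_rearrangement_of_measurable {Q : Measure Ω} [IsFiniteMeasure Q]
    (hQ : ∀ B, MeasurableSet B → ∀ c ≤ Q B, ∃ A ⊆ B, MeasurableSet A ∧ Q A = c)
    {V V' W : Ω → ℝ} (hV : Measurable V) (hV' : Measurable V') (hVV : Q.map V = Q.map V')
    (hW : Measurable W) (hWi : Integrable W Q) (hVW : Integrable (fun ω => V ω * W ω) Q)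
    {ε : ℝ} (hε : 0 < ε) :
    ∃ W' : Ω → ℝ, Measurable W' ∧ Q.map W = Q.map W' ∧
      ∫ ω, V ω * W ω ∂Q - ε ≤ ∫ ω, V' ω * W' ω ∂Q := by
  -- the values of `V` are rounded down to multiples of `δ`
  set δ : ℝ := ε / (2 * (∫ ω, |W ω| ∂Q + 1)) with hδ
  have hI : 0 ≤ ∫ ω, |W ω| ∂Q := integral_nonneg fun _ => abs_nonneg _
  have hδ0 : 0 < δ := by positivity
  let r : ℝ → ℤ := fun x => ⌊x / δ⌋
  have hr : Measurable r := Int.measurable_floor.comp (measurable_id.div_const δ)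
  have hround : ∀ x, |x - δ * r x| ≤ δ := by
    intro x
    have h1 := Int.floor_le (x / δ)
    have h2 := Int.lt_floor_add_one (x / δ)
    rw [le_div_iff₀ hδ0] at h1
    rw [div_lt_iff₀ hδ0] at h2
    rw [abs_le]
    constructor <;> simp only [r] <;> nlinarith
  obtain ⟨W', hW'm, hlaw⟩ := exists_map_prodMk_eq hQ (hr.comp hV) (hr.comp hV')
    (by rw [← Measure.map_map hr hV, hVV, Measure.map_map hr hV']) hW
  have hid : IdentDistrib (fun ω => (r (V ω), W ω)) (fun ω => (r (V' ω), W' ω)) Q Q :=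
    ⟨((hr.comp hV).prodMk hW).aemeasurable, ((hr.comp hV').prodMk hW'm).aemeasurable, hlaw⟩
  have hWW : IdentDistrib W W' Q Q := hid.comp measurable_snd
  have hmul : Measurable fun p : ℤ × ℝ => δ * (p.1 : ℝ) * p.2 :=
    ((measurable_from_top (f := fun i : ℤ => (i : ℝ))).comp measurable_fst |>.const_mul δ).mul
      measurable_snd
  have hprod : IdentDistrib (fun ω => δ * (r (V ω) : ℝ) * W ω)
      (fun ω => δ * (r (V' ω) : ℝ) * W' ω) Q Q := hid.comp hmul
  have habs : IdentDistrib (fun ω => |W ω|) (fun ω => |W' ω|) Q Q :=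
    hWW.comp measurable_norm
  have hW'i : Integrable W' Q := hWW.integrable_iff.1 hWi
  have rem_int : ∀ {T w : Ω → ℝ}, Measurable T → Integrable w Q →
      Integrable (fun ω => (T ω - δ * r (T ω)) * w ω) Q := by
    intro T w hT hw
    refine hw.bdd_mul (c := δ) ?_ (ae_of_all _ fun ω => hround (T ω))
    exact (hT.sub (((measurable_from_top (f := fun i : ℤ => (i : ℝ))).comp
      (hr.comp hT)).const_mul δ)).aestronglyMeasurable
  have rem_bound : ∀ {T w : Ω → ℝ}, Integrable w Q →
      |∫ ω, (T ω - δ * r (T ω)) * w ω ∂Q| ≤ δ * ∫ ω, |w ω| ∂Q := by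
    intro T w hw
    rw [← integral_const_mul, ← Real.norm_eq_abs]
    refine norm_integral_le_of_norm_le (hw.abs.const_mul δ) (ae_of_all _ fun ω => ?_)
    rw [norm_mul]
    exact mul_le_mul_of_nonneg_right (hround _) (norm_nonneg _)
  have split : ∀ (T w : Ω → ℝ), (fun ω => T ω * w ω) =
      (fun ω => (T ω - δ * r (T ω)) * w ω + δ * (r (T ω) : ℝ) * w ω) := by
    intro T w
    ext ω
    ring
  have hi1 : Integrable (fun ω => δ * (r (V ω) : ℝ) * W ω) Q := by
    refine (hVW.sub (rem_int hV hWi)).congr (ae_of_all _ fun ω => ?_)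
    simp only [Pi.sub_apply]
    ring
  have hi2 := hprod.integrable_iff.1 hi1
  refine ⟨W', hW'm, hWW.map_eq, ?_⟩
  have b1 := abs_le.1 (rem_bound (T := V) hWi)
  have b2 := abs_le.1 (rem_bound (T := V') hW'i)
  have hb : δ * ∫ ω, |W ω| ∂Q ≤ ε / 2 := by
    rw [hδ, div_mul_eq_mul_div, div_le_div_iff₀ (by positivity) two_pos]
    nlinarith
  rw [← habs.integral_eq] at b2
  rw [split V W, split V' W', integral_add (rem_int hV hWi) hi1,
    integral_add (rem_int hV' hW'i) hi2, hprod.integral_eq]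
  linarith [b1.2, b2.1]

/-- On an atomless space, if `V'` is distributed as `V`, then `W` has a copy `W'` with
`E[V W] - ε ≤ E[V' W']`. Equality of the joint laws of `(V, W)` and `(V', W')` cannot be asked for,
since `V'` may generate the whole σ-algebra. -/
lemma exists_rearrangement {Ω : Type*} {m mΩ : MeasurableSpace Ω} {P : Measure Ω} [IsFiniteMeasure P]
    (hm : m ≤ mΩ) (hatom : Atomless m P) {V V' W : Ω → ℝ} (hV : AEStronglyMeasurable[m] V P)
    (hV' : AEStronglyMeasurable[m] V' P) (hVV : IdentDistrib V V' P P)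
    (hW : AEStronglyMeasurable[m] W P) (hWi : Integrable W P)
    (hVW : Integrable (fun ω => V ω * W ω) P) {ε : ℝ} (hε : 0 < ε) :
    ∃ W' : Ω → ℝ, StronglyMeasurable[m] W' ∧ IdentDistrib W W' P P ∧
      ∫ ω, V ω * W ω ∂P - ε ≤ ∫ ω, V' ω * W' ω ∂P := by
  obtain ⟨v, hv, hVv⟩ := hV
  obtain ⟨v', hv', hVv'⟩ := hV'
  obtain ⟨w, hw, hWw⟩ := hW
  have hprod : (fun ω => V ω * W ω) =ᵐ[P] fun ω => v ω * w ω := hVv.mul hWw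
  have map_trim : ∀ {f : Ω → ℝ}, Measurable[m] f →
      @Measure.map Ω ℝ m _ f (P.trim hm) = P.map f := by
    intro f hf
    ext s hs
    rw [Measure.map_apply hf hs, Measure.map_apply (hf.mono hm le_rfl) hs,
      trim_measurableSet_eq hm (hf hs)]
  have hlaw : P.map v = P.map v' := by
    rw [← Measure.map_congr hVv, ← Measure.map_congr hVv', hVV.map_eq]
  have hfin : IsFiniteMeasure (P.trim hm) := isFiniteMeasure_trim hm
  obtain ⟨w', hw', hww', hle⟩ := @exists_rearrangement_of_measurable Ω m (P.trim hm) hfin (by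
      intro B hB c hc
      rw [trim_measurableSet_eq hm hB] at hc
      have : c ∈ {p : ℝ≥0∞ | ∃ A : Set Ω, A ⊆ B ∧ MeasurableSet[m] A ∧ P A = p} := by
        rw [hatom B hB]
        exact ⟨zero_le, hc⟩
      obtain ⟨A, hAB, hA, hAc⟩ := this
      exact ⟨A, hAB, hA, by rw [trim_measurableSet_eq hm hA, hAc]⟩)
    v v' w hv.measurable hv'.measurable
    (by rw [map_trim hv.measurable, map_trim hv'.measurable, hlaw]) hw.measurable
    ((hWi.congr hWw).trim hm hw) ((hVW.congr hprod).trim hm (hv.mul hw)) ε hε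
  have hw's : StronglyMeasurable[m] w' := Measurable.stronglyMeasurable hw'
  refine ⟨w', hw's, ⟨(hw.mono hm).measurable.aemeasurable.congr hWw.symm,
    (hw's.mono hm).measurable.aemeasurable, ?_⟩, ?_⟩
  · rw [Measure.map_congr hWw, ← map_trim hw.measurable, ← map_trim hw', hww']
  · have i1 : ∫ ω, v ω * w ω ∂P = ∫ ω, v ω * w ω ∂(P.trim hm) := integral_trim hm (hv.mul hw)
    have i2 : ∫ ω, v' ω * w' ω ∂P = ∫ ω, v' ω * w' ω ∂(P.trim hm) :=
      integral_trim hm (hv'.mul hw's)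
    rw [← i1, ← i2] at hle
    rw [integral_congr_ae hprod]
    refine hle.trans_eq (integral_congr_ae ?_)
    filter_upwards [hVv'] with ω h
    simp [h]

end Rearrangement

/-! ### Sublinear functionals and convex selections -/

section MazurOrlicz

variable {E : Type*} [AddCommGroup E] [Module ℝ E]

open scoped Pointwise in
/-- A form of the Mazur–Orlicz theorem: a sublinear function that is nonnegative on a convex set
dominates a linear functional that is nonnegative on this set. -/
lemma exists_linear_le_of_nonneg_on_convex {N : E → ℝ}
    (hom : ∀ c : ℝ, 0 ≤ c → ∀ x, N (c • x) = c * N x) (add : ∀ x y, N (x + y) ≤ N x + N y)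
    {A : Set E} (hA : Convex ℝ A) (hne : A.Nonempty) (h0 : ∀ a ∈ A, 0 ≤ N a) :
    ∃ g : E →ₗ[ℝ] ℝ, (∀ x, g x ≤ N x) ∧ ∀ a ∈ A, 0 ≤ g a := by
  have N0 : N 0 = 0 := by simpa using hom 0 le_rfl 0
  -- Hahn–Banach is applied to the largest sublinear function below `N` that is `≤ 0` on `-A`
  let T : E → Set ℝ := fun y => {r | ∃ t : ℝ, 0 ≤ t ∧ ∃ a ∈ A, r = N (y + t • a)}
  have Tne : ∀ y, (T y).Nonempty := fun y => ⟨_, 0, le_rfl, hne.some, hne.some_mem, rfl⟩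
  have Tlb : ∀ y, ∀ r ∈ T y, -N (-y) ≤ r := by
    rintro y r ⟨t, ht, a, ha, rfl⟩
    have h1 := add (y + t • a) (-y)
    rw [show y + t • a + -y = t • a by abel, hom t ht] at h1
    have := mul_nonneg ht (h0 a ha)
    linarith
  have Tbdd : ∀ y, BddBelow (T y) := fun y => ⟨_, Tlb y⟩
  obtain ⟨g, -, hg⟩ := exists_extension_of_le_sublinear (⊥ : E →ₗ.[ℝ] ℝ) (fun y => sInf (T y))
    (fun c hc x => by
      have : T (c • x) = c • T x := by
        ext r
        simp only [T, Set.mem_smul_set, Set.mem_ofPred_eq, smul_eq_mul]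
        constructor
        · rintro ⟨t, ht, a, ha, rfl⟩
          refine ⟨_, ⟨c⁻¹ * t, by positivity, a, ha, rfl⟩, ?_⟩
          rw [← hom c hc.le, smul_add, smul_smul, mul_inv_cancel_left₀ hc.ne']
        · rintro ⟨_, ⟨t, ht, a, ha, rfl⟩, rfl⟩
          refine ⟨c * t, by positivity, a, ha, ?_⟩
          rw [← hom c hc.le, smul_add, smul_smul]
      simp only [this, Real.sInf_smul_of_nonneg hc.le, smul_eq_mul])
    (fun x y => by
      refine le_of_forall_pos_lt_add fun ε hε => ?_
      obtain ⟨_, ⟨t, ht, a, ha, rfl⟩, h1⟩ := exists_lt_of_csInf_lt (Tne x)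
        (lt_add_of_pos_right (sInf (T x)) (half_pos hε))
      obtain ⟨_, ⟨s, hs, b, hb, rfl⟩, h2⟩ := exists_lt_of_csInf_lt (Tne y)
        (lt_add_of_pos_right (sInf (T y)) (half_pos hε))
      have hmem : ∃ u : ℝ, 0 ≤ u ∧ ∃ d ∈ A, t • a + s • b = u • d := by
        rcases (add_nonneg ht hs).eq_or_lt with h | h
        · obtain ⟨rfl, rfl⟩ : t = 0 ∧ s = 0 := ⟨by linarith, by linarith⟩
          exact ⟨0, le_rfl, a, ha, by simp⟩
        · refine ⟨t + s, h.le, _, hA ha hb (div_nonneg ht h.le) (div_nonneg hs h.le)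
            (by rw [← add_div, div_self h.ne']), ?_⟩
          rw [smul_add, smul_smul, smul_smul, mul_div_cancel₀ _ h.ne', mul_div_cancel₀ _ h.ne']
      obtain ⟨u, hu, d, hd, hud⟩ := hmem
      have h3 := csInf_le (Tbdd (x + y)) ⟨u, hu, d, hd, rfl⟩
      rw [← hud, show x + y + (t • a + s • b) = (x + t • a) + (y + s • b) by abel] at h3
      linarith [add (x + t • a) (y + s • b)])
    (by
      rintro ⟨x, hx⟩
      obtain rfl : x = 0 := (Submodule.mem_bot ℝ).1 hx
      have : 0 ≤ sInf (T 0) := le_csInf (Tne 0) fun r hr => by simpa [N0] using Tlb 0 r hr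
      refine le_trans (le_of_eq ?_) this
      exact (⊥ : E →ₗ.[ℝ] ℝ).map_zero)
  refine ⟨g, fun x => (hg x).trans (csInf_le (Tbdd x) ?_), fun a ha => ?_⟩
  · exact ⟨0, le_rfl, hne.some, hne.some_mem, by simp⟩
  · have h1 := (hg (-a)).trans (csInf_le (Tbdd (-a)) ⟨1, zero_le_one, a, ha, rfl⟩)
    rw [map_neg, one_smul, neg_add_cancel, N0] at h1
    linarith

end MazurOrlicz

section Subsequences

/-- Points of almost minimal norm in a decreasing sequence of bounded convex sets form a Cauchy
sequence, by the parallelogram law. -/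
lemma exists_cauchySeq_mem_of_antitone_convex {H : Type*} [NormedAddCommGroup H]
    [InnerProductSpace ℝ H] {C : ℕ → Set H} (hanti : Antitone C) (hne : ∀ j, (C j).Nonempty)
    (hconv : ∀ j, Convex ℝ (C j)) {R : ℝ} (hR : ∀ j, ∀ x ∈ C j, ‖x‖ ≤ R) :
    ∃ w : ℕ → H, (∀ j, w j ∈ C j) ∧ CauchySeq w := by
  let D : ℕ → ℝ := fun j => sInf ((fun x => ‖x‖ ^ 2) '' C j)
  have bdd : ∀ j, BddBelow ((fun x : H => ‖x‖ ^ 2) '' C j) := fun j =>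
    ⟨0, by rintro _ ⟨x, -, rfl⟩; positivity⟩
  have Dmono : Monotone D := fun i j hij =>
    csInf_le_csInf (bdd i) ((hne j).image _) (Set.image_mono (hanti hij))
  have Dle : ∀ j, ∀ x ∈ C j, D j ≤ ‖x‖ ^ 2 := fun j x hx => csInf_le (bdd j) ⟨x, hx, rfl⟩
  have Dbdd : BddAbove (Set.range D) := by
    refine ⟨R ^ 2, ?_⟩
    rintro _ ⟨j, rfl⟩
    obtain ⟨x, hx⟩ := hne j
    exact (Dle j x hx).trans (by gcongr; exact hR j x hx)
  have H : ∀ j : ℕ, ∃ x ∈ C j, ‖x‖ ^ 2 < D j + 1 / ((j : ℝ) + 1) := by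
    intro j
    obtain ⟨_, ⟨x, hx, rfl⟩, h⟩ := exists_lt_of_csInf_lt ((hne j).image (fun x => ‖x‖ ^ 2))
      (lt_add_of_pos_right (D j) (Nat.one_div_pos_of_nat (n := j)))
    exact ⟨x, hx, h⟩
  choose w hw hwD using H
  have hlim : Tendsto (fun j : ℕ => √(4 * (iSup D - D j) + 4 * (1 / ((j : ℝ) + 1)))) atTop
      (𝓝 0) := by
    have h1 := ((tendsto_atTop_ciSup Dmono Dbdd).const_sub (iSup D)).const_mul 4
    have h2 := (tendsto_one_div_add_atTop_nhds_zero_nat (𝕜 := ℝ)).const_mul 4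
    simpa using (h1.add h2).sqrt
  refine ⟨w, hw, cauchySeq_of_le_tendsto_0 _ (fun n k N hn hk => ?_) hlim⟩
  rw [dist_eq_norm]
  refine Real.le_sqrt_of_sq_le ?_
  have hmid : D N ≤ ‖(1 / 2 : ℝ) • w n + (1 / 2 : ℝ) • w k‖ ^ 2 := Dle N _
    (hconv N (hanti hn (hw n)) (hanti hk (hw k)) (by norm_num) (by norm_num) (by norm_num))
  rw [← smul_add, norm_smul, mul_pow] at hmid
  have hpar := parallelogram_law_with_norm ℝ (w n) (w k)
  have inv_le : ∀ l, N ≤ l → 1 / ((l : ℝ) + 1) ≤ 1 / ((N : ℝ) + 1) := fun l hl => by gcongr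
  have e1 := hwD n
  have e2 := hwD k
  have e3 := inv_le n hn
  have e4 := inv_le k hk
  have e5 := le_ciSup Dbdd n
  have e6 := le_ciSup Dbdd k
  norm_num at hmid
  nlinarith

variable {Ω : Type*} {mΩ : MeasurableSpace Ω} {P : Measure Ω} [IsFiniteMeasure P]

/-- A decreasing sequence of bounded convex sets in `L^∞` has a selection that converges almost
surely: the sets are bounded in the Hilbert space `L²`. -/
lemma exists_ae_tendsto_mem_of_antitone_convex {C : ℕ → Set (LInf P)} (hanti : Antitone C)
    (hne : ∀ j, (C j).Nonempty) (hconv : ∀ j, Convex ℝ (C j)) {R : ℝ}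
    (hR : ∀ j, ∀ x ∈ C j, ‖x‖ ≤ R) :
    ∃ (w : ℕ → LInf P) (W : LInf P), (∀ j, w j ∈ C j) ∧
      ∀ᵐ ω ∂P, Tendsto (fun j => w j ω) atTop (𝓝 (W ω)) := by
  have mem2 : ∀ X : LInf P, MemLp X 2 P := fun X => (Lp.memLp X).mono_exponent le_top
  let T : LInf P →ₗ[ℝ] Lp ℝ 2 P :=
    { toFun := fun X => (mem2 X).toLp X
      map_add' := fun X Y => by
        rw [← MemLp.toLp_add]
        exact MemLp.toLp_congr _ _ (Lp.coeFn_add X Y)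
      map_smul' := fun c X => by
        rw [RingHom.id_apply, ← MemLp.toLp_const_smul]
        exact MemLp.toLp_congr _ _ (Lp.coeFn_smul c X) }
  have Tae : ∀ X : LInf P, T X =ᵐ[P] X := fun X => (mem2 X).coeFn_toLp
  have hR0 : 0 ≤ R := (norm_nonneg _).trans (hR 0 _ (hne 0).some_mem)
  obtain ⟨y, hy, hcauchy⟩ := exists_cauchySeq_mem_of_antitone_convex
    (C := fun j => T '' C j) (R := P.real Set.univ ^ ((2 : ℝ≥0∞).toReal)⁻¹ * R)
    (fun i j hij => Set.image_mono (hanti hij)) (fun j => (hne j).image _)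
    (fun j => (hconv j).linear_image T) (by
      rintro j _ ⟨X, hX, rfl⟩
      refine Lp.norm_le_of_ae_bound hR0 ?_
      filter_upwards [Tae X, ae_abs_le_norm X] with ω h1 h2
      rw [h1, Real.norm_eq_abs]
      exact h2.trans (hR j X hX))
  choose x hx hxy using hy
  obtain ⟨F, hF⟩ := cauchySeq_tendsto_of_complete hcauchy
  obtain ⟨φ, hφ, hae⟩ := (tendstoInMeasure_of_tendsto_Lp hF).exists_seq_tendsto_ae
  have hae' : ∀ᵐ ω ∂P, Tendsto (fun j => x (φ j) ω) atTop (𝓝 (F ω)) := by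
    filter_upwards [hae, ae_all_iff.2 fun j => Tae (x (φ j))] with ω h1 h2
    refine h1.congr fun j => ?_
    rw [← hxy, h2]
  have hFR : ∀ᵐ ω ∂P, ‖F ω‖ ≤ R := by
    filter_upwards [hae', ae_all_iff.2 fun j => ae_abs_le_norm (x (φ j))] with ω h1 h2
    exact le_of_tendsto' h1.norm fun j => (h2 j).trans (hR _ _ (hx _))
  have hFmem : MemLp F ∞ P := memLp_top_of_bound (Lp.aestronglyMeasurable F) R hFR
  refine ⟨fun j => x (φ j), hFmem.toLp F, fun j => hanti (hφ.id_le j) (hx (φ j)), ?_⟩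
  filter_upwards [hae', hFmem.coeFn_toLp] with ω h1 h2
  rwa [h2]

end Subsequences

/-! ### Fatou continuity and expected excess -/

section Coherent

variable {Ω : Type*} {mΩ : MeasurableSpace Ω} {P : Measure Ω} [IsFiniteMeasure P] {ρ : LInf P → ℝ}

lemma IsCoherent.map_zero (h : IsCoherent ρ) : ρ 0 = 0 := by
  simpa using h.pos_homogeneous 0 0 le_rfl

lemma IsCoherent.map_add_le (h : IsCoherent ρ) (X Y : LInf P) : ρ (X + Y) ≤ ρ X + ρ Y := by
  have h1 := h.convex ((2 : ℝ) • X) ((2 : ℝ) • Y) (1 / 2) (by norm_num) (by norm_num)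
  rw [h.pos_homogeneous X 2 zero_le_two, h.pos_homogeneous Y 2 zero_le_two, smul_smul,
    smul_smul] at h1
  norm_num at h1
  linarith

lemma IsCoherent.map_const (h : IsCoherent ρ) (c : ℝ) : ρ (Lp.const ∞ P c) = c := by
  have := h.cash_invariant 0 c
  rwa [zero_add, h.map_zero, zero_add] at this

lemma le_const_norm (X : LInf P) : X ≤ Lp.const ∞ P ‖X‖ := by
  rw [← Lp.coeFn_le]
  filter_upwards [ae_abs_le_norm X, Lp.coeFn_const ∞ P ‖X‖] with ω h1 h2
  rw [h2]
  exact (le_abs_self _).trans h1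

omit [IsFiniteMeasure P] in
lemma IsFatou.le_of_forall_le (h : IsFatou ρ) {X : LInf P} {Xn : ℕ → LInf P} {C c : ℝ}
    (hC : ∀ n, ‖Xn n‖ ≤ C) (hlim : ∀ᵐ ω ∂P, Tendsto (fun n => Xn n ω) atTop (𝓝 (X ω)))
    (hc : ∀ n, ρ (Xn n) ≤ c) : ρ X ≤ c := by
  have h1 := h X Xn ⟨C, hC⟩ hlim
  have h2 : liminf (fun n => (ρ (Xn n) : EReal)) atTop ≤ liminf (fun _ : ℕ => (c : EReal)) atTop :=
    liminf_le_liminf (Eventually.of_forall fun n => EReal.coe_le_coe_iff.2 (hc n))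
  rw [liminf_const] at h2
  exact EReal.coe_le_coe_iff.1 (h1.trans h2)

end Coherent

section Excess

variable {Ω : Type*} {mΩ : MeasurableSpace Ω} {P : Measure Ω}

/-- The expected excess `E[(v - n)⁺]` over the level `n`. -/
noncomputable def excess (n : ℕ) (v : LInf P) : ℝ := ∫ ω, max (v ω - n) 0 ∂P

lemma excess_nonneg (n : ℕ) (v : LInf P) : 0 ≤ excess n v :=
  integral_nonneg fun _ => le_max_right _ _

variable [IsFiniteMeasure P]

lemma integrable_linf (v : LInf P) : Integrable v P := (Lp.memLp v).integrable le_top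

lemma integrable_excess (n : ℕ) (v : LInf P) : Integrable (fun ω => max (v ω - n) 0) P :=
  ((integrable_linf v).sub (integrable_const (n : ℝ))).pos_part

lemma excess_convex (n : ℕ) (v w : LInf P) {a b : ℝ} (ha : 0 ≤ a) (hb : 0 ≤ b) (hab : a + b = 1) :
    excess n (a • v + b • w) ≤ a * excess n v + b * excess n w := by
  unfold excess
  rw [← integral_const_mul, ← integral_const_mul,
    ← integral_add ((integrable_excess n v).const_mul a) ((integrable_excess n w).const_mul b)]
  refine integral_mono_ae (integrable_excess n _)
    (((integrable_excess n v).const_mul a).add ((integrable_excess n w).const_mul b)) ?_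
  filter_upwards [Lp.coeFn_add (a • v) (b • w), Lp.coeFn_smul a v, Lp.coeFn_smul b w]
    with ω h1 h2 h3
  simp only [h1, Pi.add_apply, h2, h3, Pi.smul_apply, smul_eq_mul]
  have e1 := mul_le_mul_of_nonneg_left (le_max_left (v ω - n) 0) ha
  have e2 := mul_le_mul_of_nonneg_left (le_max_left (w ω - n) 0) hb
  have e3 := mul_nonneg ha (le_max_right (v ω - n) 0)
  have e4 := mul_nonneg hb (le_max_right (w ω - n) 0)
  have e5 : (n : ℝ) = a * n + b * n := by rw [← add_mul, hab, one_mul]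
  exact max_le (by linarith) (by linarith)

lemma tendsto_excess (n : ℕ) {v : ℕ → LInf P} {w : LInf P} {C : ℝ} (hC : ∀ j, ‖v j‖ ≤ C)
    (h : ∀ᵐ ω ∂P, Tendsto (fun j => v j ω) atTop (𝓝 (w ω))) :
    Tendsto (fun j => excess n (v j)) atTop (𝓝 (excess n w)) := by
  refine tendsto_integral_of_dominated_convergence (fun _ => C + n)
    (fun j => (integrable_excess n (v j)).aestronglyMeasurable) (integrable_const _)
    (fun j => ?_) ?_
  · filter_upwards [ae_abs_le_norm (v j)] with ω hω
    have h0 := (abs_nonneg _).trans hω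
    have h1 := hC j
    have h2 := (abs_le.1 hω).2
    have h3 : (0 : ℝ) ≤ n := Nat.cast_nonneg n
    rw [Real.norm_eq_abs, abs_of_nonneg (le_max_right _ _)]
    exact max_le (by linarith) (by linarith)
  · filter_upwards [h] with ω hω
    exact (hω.sub_const _).max tendsto_const_nhds

/-- Random variables `0 ≤ v ≤ N` whose expected excess over each level `n < N` is at most `ε n`. -/
noncomputable def excessSet (P : Measure Ω) (ε : ℕ → ℝ) (N : ℕ) : Set (LInf P) :=
  {v | (∀ᵐ ω ∂P, 0 ≤ v ω) ∧ (∀ᵐ ω ∂P, v ω ≤ N) ∧ ∀ n < N, excess n v ≤ ε n}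

lemma convex_excessSet (ε : ℕ → ℝ) (N : ℕ) : Convex ℝ (excessSet P ε N) := by
  rintro v ⟨hv0, hvN, hv⟩ w ⟨hw0, hwN, hw⟩ a b ha hb hab
  refine ⟨?_, ?_, fun n hn => ?_⟩
  · filter_upwards [Lp.coeFn_add (a • v) (b • w), Lp.coeFn_smul a v, Lp.coeFn_smul b w, hv0, hw0]
      with ω h1 h2 h3 h4 h5
    simp only [h1, Pi.add_apply, h2, h3, Pi.smul_apply, smul_eq_mul]
    positivity
  · filter_upwards [Lp.coeFn_add (a • v) (b • w), Lp.coeFn_smul a v, Lp.coeFn_smul b w, hvN, hwN]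
      with ω h1 h2 h3 h4 h5
    simp only [h1, Pi.add_apply, h2, h3, Pi.smul_apply, smul_eq_mul]
    have e5 : (N : ℝ) = a * N + b * N := by rw [← add_mul, hab, one_mul]
    rw [e5]
    gcongr
  · have e5 : ε n = a * ε n + b * ε n := by rw [← add_mul, hab, one_mul]
    rw [e5]
    refine (excess_convex n v w ha hb hab).trans ?_
    gcongr
    exacts [hv n hn, hw n hn]

omit [IsFiniteMeasure P] in
lemma norm_le_of_mem_excessSet {ε : ℕ → ℝ} {N : ℕ} {v : LInf P} (hv : v ∈ excessSet P ε N) :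
    ‖v‖ ≤ N := by
  refine norm_le_of_ae_abs_le (Nat.cast_nonneg N) ?_
  filter_upwards [hv.1, hv.2.1] with ω h1 h2
  rwa [abs_of_nonneg h1]

/-- Suppose that `ρ` is positive at `X - v` for all `v ∈ excessSet P ε N`. Then the same holds with
`N + 1` in place of `N` if the bound for the excess over `N` is small: otherwise the counterexamples
for the bounds `2⁻ʲ` have a limit in `excessSet P ε N`, which contradicts Fatou continuity. -/
lemma exists_excess_bound {ρ : LInf P → ℝ} (hρ : IsCoherent ρ) (hF : IsFatou ρ) (X : LInf P)
    (N : ℕ) (ε : ℕ → ℝ) (h : ∀ v ∈ excessSet P ε N, 0 < ρ (X - v)) :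
    ∃ δ > 0, ∀ v ∈ excessSet P (Function.update ε N δ) (N + 1), 0 < ρ (X - v) := by
  by_contra! hcon
  have hupd : ∀ δ, ∀ n < N, Function.update ε N δ n = ε n := fun δ n hn =>
    Function.update_of_ne hn.ne _ _
  obtain ⟨v, w, hv, hlim⟩ := exists_ae_tendsto_mem_of_antitone_convex (P := P)
    (C := fun j => {v | v ∈ excessSet P (Function.update ε N ((1 / 2) ^ j)) (N + 1) ∧
      ρ (X - v) ≤ 0}) (R := (N + 1 : ℕ)) (fun i j hij v hv => by
        refine ⟨⟨hv.1.1, hv.1.2.1, fun n hn => (hv.1.2.2 n hn).trans ?_⟩, hv.2⟩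
        rcases (Nat.lt_succ_iff.1 hn).eq_or_lt with rfl | hn
        · rw [Function.update_self, Function.update_self]
          exact pow_le_pow_of_le_one (by norm_num) (by norm_num) hij
        · rw [hupd _ n hn, hupd _ n hn])
    (fun j => hcon ((1 / 2) ^ j) (by positivity)) (fun j => by
      rintro v ⟨hv, hv0⟩ w ⟨hw, hw0⟩ a b ha hb hab
      refine ⟨convex_excessSet _ _ hv hw ha hb hab, ?_⟩
      rw [show X - (a • v + b • w) = a • (X - v) + b • (X - w) by
        conv_lhs => rw [← one_smul ℝ X, ← hab]
        module]
      refine (hρ.map_add_le _ _).trans ?_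
      rw [hρ.pos_homogeneous _ a ha, hρ.pos_homogeneous _ b hb]
      nlinarith)
    (fun j v hv => norm_le_of_mem_excessSet hv.1)
  have hnorm : ∀ j, ‖v j‖ ≤ (N + 1 : ℕ) := fun j => norm_le_of_mem_excessSet (hv j).1
  have hw : w ∈ excessSet P ε N := by
    refine ⟨?_, ?_, fun n hn => ?_⟩
    · filter_upwards [hlim, ae_all_iff.2 fun j => (hv j).1.1] with ω h1 h2
      exact ge_of_tendsto' h1 h2
    · have h0 : excess N w ≤ 0 := by
        refine le_of_tendsto_of_tendsto' (tendsto_excess N hnorm hlim)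
          (tendsto_pow_atTop_nhds_zero_of_lt_one (r := (1 / 2 : ℝ)) (by norm_num) (by norm_num))
          fun j => ?_
        simpa using (hv j).1.2.2 N N.lt_succ_self
      have h1 := (integral_eq_zero_iff_of_nonneg (fun _ => le_max_right _ _)
        (integrable_excess N w)).1 (le_antisymm h0 (excess_nonneg N w))
      filter_upwards [h1] with ω hω
      have h2 : w ω - N ≤ 0 := max_eq_right_iff.1 hω
      linarith
    · refine le_of_tendsto' (tendsto_excess n hnorm hlim) fun j => ?_
      have := (hv j).1.2.2 n (hn.trans N.lt_succ_self)
      rwa [hupd _ n hn] at this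
  refine absurd (h w hw) (not_lt.2 ?_)
  refine hF.le_of_forall_le (Xn := fun j => X - v j) (C := ‖X‖ + (N + 1 : ℕ))
    (fun j => (norm_sub_le _ _).trans (by gcongr; exact hnorm j)) ?_ fun j => (hv j).2
  filter_upwards [hlim, Lp.coeFn_sub X w, ae_all_iff.2 fun j => Lp.coeFn_sub X (v j)]
    with ω h1 h2 h3
  simp only [h2, h3, Pi.sub_apply]
  exact h1.const_sub _

/-- Bounds `ε n` for the expected excesses under which `ρ (X - v)` stays positive, chosen one after
another: `e N` holds the final values of the first `N` bounds. -/
lemma exists_excess_bounds {ρ : LInf P → ℝ} (hρ : IsCoherent ρ) (hF : IsFatou ρ) {X : LInf P}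
    (hX : 0 < ρ X) :
    ∃ ε : ℕ → ℝ, (∀ n, 0 < ε n) ∧ ∀ N, ∀ v ∈ excessSet P ε N, 0 < ρ (X - v) := by
  have H : ∀ (N : ℕ) (ε : ℕ → ℝ), ∃ δ > 0, (∀ v ∈ excessSet P ε N, 0 < ρ (X - v)) →
      ∀ v ∈ excessSet P (Function.update ε N δ) (N + 1), 0 < ρ (X - v) := by
    intro N ε
    by_cases h : ∀ v ∈ excessSet P ε N, 0 < ρ (X - v)
    · obtain ⟨δ, hδ, h'⟩ := exists_excess_bound hρ hF X N ε h
      exact ⟨δ, hδ, fun _ => h'⟩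
    · exact ⟨1, one_pos, fun h' => absurd h' h⟩
  choose δ hδ hstep using H
  obtain ⟨e, he0, he⟩ : ∃ e : ℕ → ℕ → ℝ, e 0 = (fun _ => 1) ∧
      ∀ N, e (N + 1) = Function.update (e N) N (δ N (e N)) :=
    ⟨fun N => Nat.rec (fun _ => 1) (fun N ε => Function.update ε N (δ N ε)) N, rfl, fun _ => rfl⟩
  have hpos : ∀ N, ∀ v ∈ excessSet P (e N) N, 0 < ρ (X - v) := by
    intro N
    induction N with
    | zero =>
      intro v hv
      have : v = 0 := by
        refine Lp.ext ?_
        filter_upwards [hv.1, hv.2.1, Lp.coeFn_zero ℝ ∞ P] with ω h1 h2 h3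
        rw [h3]
        exact le_antisymm (by simpa using h2) h1
      rwa [this, sub_zero]
    | succ N ih =>
      rw [he]
      exact hstep N (e N) ih
  have hstab : ∀ n N, n < N → e N n = e (n + 1) n := by
    intro n N hn
    induction N, hn using Nat.le_induction with
    | base => rfl
    | succ N hN ih =>
      rw [he N, Function.update_of_ne (by omega), ih]
  refine ⟨fun n => e (n + 1) n, fun n => ?_, fun N v hv => hpos N v ⟨hv.1, hv.2.1, fun n hn => ?_⟩⟩
  · dsimp only
    rw [he, Function.update_self]
    exact hδ _ _
  · rw [hstab n N hn]
    exact hv.2.2 n hn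

end Excess

/-! ### Representation by the supporting set -/

section Representation

variable {Ω : Type*} {mΩ : MeasurableSpace Ω} {P : Measure Ω} [IsFiniteMeasure P]

open Classical in
/-- The indicator of a set as an element of `L^∞`, with value `0` at nonmeasurable sets. -/
noncomputable def ind (P : Measure Ω) [IsFiniteMeasure P] (A : Set Ω) : LInf P :=
  if hA : MeasurableSet A then indicatorConstLp ∞ hA (measure_ne_top P A) 1 else 0

lemma ind_ae {A : Set Ω} (hA : MeasurableSet A) : ind P A =ᵐ[P] A.indicator 1 := by
  rw [ind, dif_pos hA]
  exact indicatorConstLp_coeFn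

lemma ind_univ : ind P Set.univ = Lp.const ∞ P 1 := by
  refine Lp.ext ?_
  filter_upwards [ind_ae (P := P) MeasurableSet.univ, Lp.coeFn_const ∞ P (1 : ℝ)] with ω h1 h2
  rw [h1, h2]
  simp

lemma ind_of_measure_zero {A : Set Ω} (hA : MeasurableSet A) (h : P A = 0) : ind P A = 0 := by
  refine Lp.ext ?_
  filter_upwards [ind_ae hA, Lp.coeFn_zero ℝ ∞ P, measure_eq_zero_iff_ae_notMem.1 h]
    with ω h1 h2 h3
  rw [h1, h2]
  simp [h3]

lemma ind_union {A B : Set Ω} (hA : MeasurableSet A) (hB : MeasurableSet B) (h : Disjoint A B) :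
    ind P (A ∪ B) = ind P A + ind P B := by
  refine Lp.ext ?_
  filter_upwards [ind_ae (P := P) hA, ind_ae (P := P) hB, ind_ae (P := P) (hA.union hB),
    Lp.coeFn_add (ind P A) (ind P B)] with ω h1 h2 h3 h4
  rw [h3, h4, Pi.add_apply, h1, h2, Set.indicator_union_of_disjoint h]

lemma ind_biUnion {f : ℕ → Set Ω} (hf : ∀ i, MeasurableSet (f i))
    (hd : Pairwise (Function.onFun Disjoint f)) (s : Finset ℕ) :
    ind P (⋃ i ∈ s, f i) = ∑ i ∈ s, ind P (f i) := by
  induction s using Finset.induction_on with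
  | empty => simpa using ind_of_measure_zero (P := P) MeasurableSet.empty measure_empty
  | insert a s ha ih =>
    rw [Finset.set_biUnion_insert, ind_union (hf a) (s.measurableSet_biUnion fun i _ => hf i),
      Finset.sum_insert ha, ih]
    exact Set.disjoint_iUnion₂_right.2 fun i hi => hd fun h => ha (h ▸ hi)

/-- A positive linear functional on `L^∞` for which the indicators of sets of small probability
have small values is given by a measure on these indicators. -/
lemma exists_measure_of_functional (ℓ : LInf P →ₗ[ℝ] ℝ) (hpos : ∀ Y, 0 ≤ Y → 0 ≤ ℓ Y)
    (hone : ℓ (Lp.const ∞ P 1) = 1)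
    (hcont : ∀ η > 0, ∃ δ > 0, ∀ B, MeasurableSet B → P.real B < δ → ℓ (ind P B) ≤ η) :
    ∃ μ ∈ PMeas (le_refl mΩ) P, ∀ A, MeasurableSet A → μ.1 A = ℓ (ind P A) := by
  have ind_nonneg : ∀ A, MeasurableSet A → 0 ≤ ind P A := by
    intro A hA
    rw [← Lp.coeFn_nonneg]
    filter_upwards [ind_ae hA] with ω h
    rw [h]
    exact Set.indicator_nonneg (fun _ _ => zero_le_one) ω
  classical
  let μ : SignedMeasure Ω :=
    { measureOf' := fun A => if MeasurableSet A then ℓ (ind P A) else 0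
      empty' := by
        rw [if_pos MeasurableSet.empty, ind_of_measure_zero MeasurableSet.empty measure_empty,
          ℓ.map_zero]
      not_measurable' := fun A hA => if_neg hA
      m_iUnion' := by
        intro f hf hd
        have hU : MeasurableSet (⋃ i, f i) := .iUnion hf
        simp only [if_pos hU, if_pos (hf _)]
        -- the tails of the series are values of `ℓ` at indicators of sets of small probability
        have key : ∀ s : Finset ℕ,
            ℓ (ind P (⋃ i, f i)) - ∑ i ∈ s, ℓ (ind P (f i)) =
              ℓ (ind P ((⋃ i, f i) \ ⋃ i ∈ s, f i)) ∧
            P.real ((⋃ i, f i) \ ⋃ i ∈ s, f i) =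
              P.real (⋃ i, f i) - ∑ i ∈ s, P.real (f i) := by
          intro s
          have hs : MeasurableSet (⋃ i ∈ s, f i) := s.measurableSet_biUnion fun i _ => hf i
          have hsub : (⋃ i ∈ s, f i) ⊆ ⋃ i, f i := Set.iUnion₂_subset fun i _ =>
            Set.subset_iUnion f i
          constructor
          · rw [← map_sum, ← ind_biUnion hf hd, sub_eq_iff_eq_add', ← map_add,
              ← ind_union hs (hU.diff hs) Set.disjoint_sdiff_right, Set.union_sdiff_cancel hsub]
          · rw [measureReal_sdiff hsub hs,
              measureReal_biUnion_finset (fun i _ j _ hij => hd hij) fun i _ => hf i]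
        have hP : HasSum (fun i => P.real (f i)) (P.real (⋃ i, f i)) := by
          have := P.toSignedMeasure.m_iUnion hf hd
          simpa [Measure.toSignedMeasure_apply_measurable, hf, hU] using this
        rw [HasSum, SummationFilter.unconditional_filter, Metric.tendsto_nhds] at hP ⊢
        intro η hη
        obtain ⟨δ, hδ, hB⟩ := hcont (η / 2) (half_pos hη)
        filter_upwards [hP δ hδ] with s hs
        have hm : MeasurableSet ((⋃ i, f i) \ ⋃ i ∈ s, f i) :=
          hU.diff (s.measurableSet_biUnion fun i _ => hf i)
        rw [dist_comm, Real.dist_eq, ← (key s).2] at hs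
        rw [dist_comm, Real.dist_eq, (key s).1, abs_of_nonneg (hpos _ (ind_nonneg _ hm))]
        exact (hB _ hm ((le_abs_self _).trans_lt hs)).trans_lt (half_lt_self hη) }
  have hμ : ∀ A, MeasurableSet A → μ A = ℓ (ind P A) := fun A hA => if_pos hA
  refine ⟨⟨μ, VectorMeasure.AbsolutelyContinuous.mk fun A hA h0 => ?_⟩, ⟨fun A hA => ?_, ?_⟩, hμ⟩
  · rw [Measure.toENNRealVectorMeasure_apply_measurable hA, trim_eq_self] at h0
    rw [hμ A hA, ind_of_measure_zero hA h0, ℓ.map_zero]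
  · exact (hpos _ (ind_nonneg A hA)).trans_eq (hμ A hA).symm
  · exact (hμ _ MeasurableSet.univ).trans (by rw [ind_univ, hone])

omit [IsFiniteMeasure P] in
/-- Simple functions are dense in `L^∞`: the rounded values `δ ⌊X / δ⌋` of a bounded version of `X`
form a finite set. -/
lemma exists_simpleFunc_norm_sub_le (X : LInf P) {δ : ℝ} (hδ : 0 < δ) :
    ∃ (f : SimpleFunc Ω ℝ) (hf : MemLp f ∞ P), ‖X - hf.toLp f‖ ≤ δ := by
  have hXm := (Lp.stronglyMeasurable X).measurable
  let c : Ω → ℝ := fun ω => max (-‖X‖) (min (X ω) ‖X‖)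
  have hc : Measurable c := measurable_const.max (hXm.min measurable_const)
  have hr : Measurable fun ω => δ * (⌊c ω / δ⌋ : ℝ) :=
    ((measurable_from_top (f := fun i : ℤ => (i : ℝ))).comp
      (Int.measurable_floor.comp (hc.div_const δ))).const_mul δ
  let f : SimpleFunc Ω ℝ :=
    { toFun := fun ω => δ * (⌊c ω / δ⌋ : ℝ)
      measurableSet_fiber' := fun x => hr (measurableSet_singleton x)
      finite_range' := by
        refine ((Set.finite_Icc ⌊-‖X‖ / δ⌋ ⌊‖X‖ / δ⌋).image fun i : ℤ => δ * (i : ℝ)).subset ?_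
        rintro _ ⟨ω, rfl⟩
        refine ⟨⌊c ω / δ⌋, ⟨Int.floor_le_floor ?_, Int.floor_le_floor ?_⟩, rfl⟩
        · exact div_le_div_of_nonneg_right (le_max_left _ _) hδ.le
        · exact div_le_div_of_nonneg_right
            (max_le (neg_le_self (norm_nonneg _)) (min_le_right _ _)) hδ.le }
  have hf : MemLp f ∞ P := f.memLp_top P
  refine ⟨f, hf, norm_le_of_ae_abs_le hδ.le ?_⟩
  filter_upwards [Lp.coeFn_sub X (hf.toLp f), hf.coeFn_toLp, ae_abs_le_norm X] with ω h1 h2 h3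
  have hcX : c ω = X ω := by
    simp only [c]
    rw [min_eq_left (abs_le.1 h3).2, max_eq_right (abs_le.1 h3).1]
  have e1 := Int.floor_le (X ω / δ)
  have e2 := Int.lt_floor_add_one (X ω / δ)
  rw [le_div_iff₀ hδ] at e1
  rw [div_lt_iff₀ hδ] at e2
  rw [h1, Pi.sub_apply, h2]
  change |X ω - δ * (⌊c ω / δ⌋ : ℝ)| ≤ δ
  rw [hcX, abs_le]
  constructor <;> nlinarith

lemma expect_ind {μ : SMeas (le_refl mΩ) P} {A : Set Ω} (hA : MeasurableSet A) :
    expect μ (ind P A) = μ.1 A := by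
  rw [← setIntegral_density μ hA, ← integral_indicator hA]
  refine integral_congr_ae ?_
  filter_upwards [ind_ae hA] with ω h
  rw [h]
  by_cases hω : ω ∈ A <;> simp [hω]

/-- A norm-bounded functional that agrees with a probability measure on indicators is its
expectation, as simple functions are dense. -/
lemma eq_expect_of_ind {ℓ : LInf P →ₗ[ℝ] ℝ} (hℓ : ∀ X, |ℓ X| ≤ ‖X‖) {μ : SMeas (le_refl mΩ) P}
    (hμ : μ ∈ PMeas (le_refl mΩ) P) (h : ∀ A, MeasurableSet A → μ.1 A = ℓ (ind P A))
    (X : LInf P) : ℓ X = expect μ X := by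
  have simple : ∀ (f : SimpleFunc Ω ℝ) (hf : MemLp f ∞ P),
      ℓ (hf.toLp f) = expect μ (hf.toLp f) := by
    intro f
    induction f using SimpleFunc.induction with
    | const c hs =>
      rename_i s
      intro hf
      have : hf.toLp _ = c • ind P s := by
        refine Lp.ext ?_
        filter_upwards [hf.coeFn_toLp, Lp.coeFn_smul c (ind P s), ind_ae (P := P) hs]
          with ω h1 h2 h3
        rw [h1, h2, Pi.smul_apply, h3]
        by_cases hω : ω ∈ s <;> simp [hω]
      rw [this, map_smul, expect_smul_right, expect_ind hs, h s hs, smul_eq_mul]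
    | @add f g _ ihf ihg =>
      intro hfg
      have hf := f.memLp_top P
      have hg := g.memLp_top P
      have : hfg.toLp _ = hf.toLp f + hg.toLp g := by
        rw [← MemLp.toLp_add]
        rfl
      rw [this, map_add, expect_add_right, ihf hf, ihg hg]
  have expect_le : ∀ Y : LInf P, |expect μ Y| ≤ ‖Y‖ := by
    intro Y
    have e1 := (expect_mono hμ (le_const_norm Y)).trans_eq (expect_const hμ _)
    have e2 := (expect_mono hμ (le_const_norm (-Y))).trans_eq (expect_const hμ _)
    rw [← neg_one_smul ℝ, expect_smul_right, neg_one_smul, norm_neg] at e2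
    exact abs_le.2 ⟨by linarith, e1⟩
  refine eq_of_abs_sub_nonpos (le_of_forall_pos_le_add fun δ hδ => ?_)
  obtain ⟨f, hf, hXf⟩ := exists_simpleFunc_norm_sub_le X (half_pos hδ)
  have e1 := (hℓ _).trans hXf
  have e2 := (expect_le _).trans hXf
  rw [map_sub, simple f hf] at e1
  rw [sub_eq_add_neg, ← neg_one_smul ℝ, expect_add_right, expect_smul_right] at e2
  rw [abs_le] at e1 e2 ⊢
  constructor <;> linarith

/-- For `P(B)` small, `n 1_B` satisfies all the bounds `ε i` on the expected excess; only those with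
`i < n` restrict `P(B)`. -/
lemma exists_excess_smul_ind_le {ε : ℕ → ℝ} (hε : ∀ n, 0 < ε n) (n : ℕ) :
    ∃ δ > 0, ∀ B, MeasurableSet B → P.real B < δ →
      (∀ᵐ ω ∂P, 0 ≤ ((n : ℝ) • ind P B : LInf P) ω) ∧ ∀ i, excess i ((n : ℝ) • ind P B) ≤ ε i := by
  have hδ : ∃ δ > 0, ∀ i < n, n * δ ≤ ε i := by
    have h1 : ∀ᶠ δ in 𝓝[>] (0 : ℝ), ∀ i ∈ Finset.range n, n * δ ≤ ε i := by
      refine (Finset.eventually_all _).2 fun i _ => ?_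
      have : Tendsto (fun δ : ℝ => n * δ) (𝓝[>] 0) (𝓝 (n * 0)) :=
        (tendsto_id.const_mul _).mono_left nhdsWithin_le_nhds
      rw [mul_zero] at this
      exact (this.eventually_lt_const (hε i)).mono fun _ h => h.le
    obtain ⟨δ, h2, h3⟩ := (h1.and self_mem_nhdsWithin).exists
    exact ⟨δ, h3, fun i hi => h2 i (Finset.mem_range.2 hi)⟩
  obtain ⟨δ, hδ0, hδ⟩ := hδ
  refine ⟨δ, hδ0, fun B hB hPB => ?_⟩
  have hae : ((n : ℝ) • ind P B : LInf P) =ᵐ[P] B.indicator fun _ => (n : ℝ) := by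
    filter_upwards [Lp.coeFn_smul (n : ℝ) (ind P B), ind_ae (P := P) hB] with ω h1 h2
    rw [h1, Pi.smul_apply, h2]
    by_cases hω : ω ∈ B <;> simp [hω]
  refine ⟨?_, fun i => ?_⟩
  · filter_upwards [hae] with ω h
    rw [h]
    exact Set.indicator_nonneg (fun _ _ => Nat.cast_nonneg n) ω
  · have hex : excess i ((n : ℝ) • ind P B) = P.real B * max ((n : ℝ) - i) 0 := by
      have : excess i ((n : ℝ) • ind P B) = ∫ ω, B.indicator (fun _ => max ((n : ℝ) - i) 0) ω ∂P := by
        refine integral_congr_ae ?_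
        filter_upwards [hae] with ω h
        simp only [h]
        by_cases hω : ω ∈ B <;> simp [hω]
      rw [this, integral_indicator hB, setIntegral_const, smul_eq_mul]
    rw [hex]
    rcases lt_or_ge i n with hi | hi
    · refine le_trans ?_ (hδ i hi)
      rw [mul_comm]
      have : max ((n : ℝ) - i) 0 ≤ n := max_le (by simp) (Nat.cast_nonneg n)
      exact mul_le_mul this hPB.le measureReal_nonneg (Nat.cast_nonneg n)
    · rw [max_eq_right (sub_nonpos.2 (by exact_mod_cast hi)), mul_zero]
      exact (hε i).le

/-- The supporting set of a Fatou continuous coherent `ρ` contains a measure under which `X` has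
nonnegative expectation, if `ρ X > 0`. -/
lemma exists_mem_supportingSet_nonneg {ρ : LInf P → ℝ} (hρ : IsCoherent ρ) (hF : IsFatou ρ)
    {X : LInf P} (hX : 0 < ρ X) : ∃ μ ∈ supportingSet ρ, 0 ≤ expect μ X := by
  obtain ⟨ε, hε, hpos⟩ := exists_excess_bounds hρ hF hX
  let W : Set (LInf P) := {v | (∀ᵐ ω ∂P, 0 ≤ v ω) ∧ ∀ n, excess n v ≤ ε n}
  have hW : ∀ v ∈ W, ∀ᶠ N in atTop, v ∈ excessSet P ε N := by
    rintro v ⟨hv0, hv⟩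
    filter_upwards [eventually_ge_atTop ⌈‖v‖⌉₊] with N hN
    refine ⟨hv0, ?_, fun n _ => hv n⟩
    filter_upwards [ae_abs_le_norm v] with ω hω
    exact (le_abs_self _).trans (hω.trans (Nat.ceil_le.1 hN))
  have hWconv : Convex ℝ W := by
    intro v hv w hw a b ha hb hab
    have H : ∀ᶠ N in atTop, a • v + b • w ∈ excessSet P ε N := by
      filter_upwards [hW v hv, hW w hw] with N h1 h2
      exact convex_excessSet ε N h1 h2 ha hb hab
    refine ⟨H.exists.choose_spec.1, fun n => ?_⟩
    obtain ⟨N, hN, hnN⟩ := (H.and (eventually_gt_atTop n)).exists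
    exact hN.2.2 n hnN
  have hmem : ∀ n : ℕ, ∃ δ > 0, ∀ B, MeasurableSet B → P.real B < δ → (n : ℝ) • ind P B ∈ W :=
    fun n => exists_excess_smul_ind_le hε n
  have hzero : (0 : LInf P) ∈ W := by
    obtain ⟨δ, hδ, h⟩ := hmem 0
    simpa using h ∅ MeasurableSet.empty (by simpa using hδ)
  obtain ⟨ℓ, hℓ, hℓW⟩ := exists_linear_le_of_nonneg_on_convex (N := ρ)
    (fun c hc x => hρ.pos_homogeneous x c hc) hρ.map_add_le (A := (fun v => X - v) '' W)
    (by
      rintro _ ⟨v, hv, rfl⟩ _ ⟨w, hw, rfl⟩ a b ha hb hab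
      refine ⟨_, hWconv hv hw ha hb hab, ?_⟩
      dsimp only
      conv_lhs => rw [← one_smul ℝ X, ← hab]
      module)
    ⟨_, 0, hzero, rfl⟩ (by
      rintro _ ⟨v, hv, rfl⟩
      obtain ⟨N, hN⟩ := (hW v hv).exists
      exact (hpos N v hN).le)
  have hℓle : ∀ v ∈ W, ℓ v ≤ ℓ X := fun v hv => by
    have := hℓW _ ⟨v, hv, rfl⟩
    rw [map_sub] at this
    linarith
  have hℓX : 0 ≤ ℓ X := by simpa using hℓle 0 hzero
  have hℓpos : ∀ Y, 0 ≤ Y → 0 ≤ ℓ Y := by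
    intro Y hY
    have := (hℓ (-Y)).trans (hρ.monotone (-Y) 0 (neg_nonpos.2 hY))
    rw [map_neg, hρ.map_zero] at this
    linarith
  have hℓnorm : ∀ Y, ℓ Y ≤ ‖Y‖ := fun Y =>
    (hℓ Y).trans ((hρ.monotone _ _ (le_const_norm Y)).trans_eq (hρ.map_const _))
  have hℓone : ℓ (Lp.const ∞ P 1) = 1 := by
    refine le_antisymm ((hℓ _).trans_eq (hρ.map_const 1)) ?_
    have := hℓ (Lp.const ∞ P (-1))
    rw [hρ.map_const, map_neg, map_neg] at this
    linarith
  obtain ⟨μ, hμ, hμℓ⟩ := exists_measure_of_functional ℓ hℓpos hℓone (by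
    intro η hη
    obtain ⟨n, hn⟩ := exists_nat_gt (ℓ X / η)
    obtain ⟨δ, hδ, h⟩ := hmem n
    refine ⟨δ, hδ, fun B hB hPB => ?_⟩
    have h1 := hℓle _ (h B hB hPB)
    have hn0 : (0 : ℝ) < n := (div_nonneg hℓX hη.le).trans_lt hn
    rw [map_smul, smul_eq_mul] at h1
    rw [div_lt_iff₀ hη] at hn
    exact (lt_of_mul_lt_mul_left (h1.trans_lt hn) hn0.le).le)
  have hrep := eq_expect_of_ind (ℓ := ℓ) (fun Y => abs_le.2 ⟨by
    have := hℓnorm (-Y)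
    rw [map_neg, norm_neg] at this
    linarith, hℓnorm Y⟩) hμ hμℓ
  exact ⟨μ, ⟨hμ, fun Y => hrep Y ▸ hℓ Y⟩, hrep X ▸ hℓX⟩

/-- A Fatou continuous coherent `ρ` is the supremum of the expectations under its supporting set. -/
lemma isLUB_supportingSet {ρ : LInf P → ℝ} (hρ : IsCoherent ρ) (hF : IsFatou ρ) (X : LInf P) :
    IsLUB ((fun μ => expect μ X) '' supportingSet ρ) (ρ X) := by
  refine ⟨?_, fun b hb => le_of_forall_lt fun c hc => ?_⟩
  · rintro _ ⟨μ, hμ, rfl⟩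
    exact hμ.2 X
  · obtain ⟨d, hcd, hd⟩ := exists_between hc
    obtain ⟨μ, hμ, h⟩ := exists_mem_supportingSet_nonneg hρ hF (X := X + Lp.const ∞ P (-d))
      (by rw [hρ.cash_invariant]; linarith)
    rw [expect_add_right, expect_const hμ.1] at h
    have : expect μ X ≤ b := hb ⟨μ, hμ, rfl⟩
    linarith

lemma convex_supportingSet (ρ : LInf P → ℝ) : Convex ℝ (supportingSet ρ) := by
  rintro μ ⟨⟨hμ0, hμ1⟩, hμ⟩ ν ⟨⟨hν0, hν1⟩, hν⟩ a b ha hb hab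
  refine ⟨⟨fun A hA => ?_, ?_⟩, fun X => ?_⟩
  · change 0 ≤ a * μ.1 A + b * ν.1 A
    have h1 := hμ0 A hA
    have h2 := hν0 A hA
    positivity
  · change a * μ.1 Set.univ + b * ν.1 Set.univ = 1
    rw [hμ1, hν1, mul_one, mul_one, hab]
  · rw [expect_add_left, expect_smul_left, expect_smul_left]
    calc a * expect μ X + b * expect ν X ≤ a * ρ X + b * ρ X := by
          gcongr
          exacts [hμ X, hν X]
      _ = ρ X := by rw [← add_mul, hab, one_mul]

end Representation

/-! ### Weak closures and law invariance -/

section Closure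

/-- By the Hahn–Banach theorem, the closure of a convex set `s` for the weak topology of a pairing
contains the points that satisfy every inequality `B · y ≤ c` valid on `s`. -/
lemma mem_closure_induced_of_forall_le {E F : Type*} [AddCommGroup E] [Module ℝ E]
    [AddCommGroup F] [Module ℝ F] (B : E →ₗ[ℝ] F →ₗ[ℝ] ℝ) {s : Set E} (hs : Convex ℝ s) {x : E}
    (h : ∀ y c, (∀ a ∈ s, B a y ≤ c) → B x y ≤ c) :
    x ∈ @closure E (TopologicalSpace.induced (fun x y => B x y) inferInstance) s := by
  by_contra hx
  let s' : Set (WeakBilin B) := s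
  have hs' : Convex ℝ s' := hs
  obtain ⟨f, u, hfs, hfx⟩ := geometric_hahn_banach_closed_point (s := closure s')
    (x := (x : WeakBilin B)) hs'.closure isClosed_closure hx
  obtain ⟨y, rfl⟩ := LinearMap.dualEmbedding_surjective B f
  exact absurd (h y u fun a ha => (hfs a (subset_closure ha)).le) (not_le.2 hfx)

variable {Ω : Type*} {m mΩ : MeasurableSpace Ω} {P : Measure Ω} [IsFiniteMeasure P]

/-- The pairing `(μ, X) ↦ E^μ[X]` of `ℳ(𝒢)` and `L^∞(𝒢)`. -/
noncomputable def expectBilin (hm : m ≤ mΩ) (P : Measure Ω) [IsFiniteMeasure P] :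
    SMeas hm P →ₗ[ℝ] LInfSub m P →ₗ[ℝ] ℝ :=
  LinearMap.mk₂ ℝ (fun μ X => expect μ X.1) (fun μ ν X => expect_add_left μ ν X.1)
    (fun c μ X => expect_smul_left c μ X.1) (fun μ X Y => expect_add_right μ X.1 Y.1)
    (fun c μ X => expect_smul_right μ c X.1)

omit [IsFiniteMeasure P] in
lemma restrictTo_add_smul (hm : m ≤ mΩ) (μ ν : SMeas (le_refl mΩ) P) (a b : ℝ) :
    restrictTo hm (a • μ + b • ν) = a • restrictTo hm μ + b • restrictTo hm ν := by
  refine Subtype.ext (VectorMeasure.ext fun A hA => ?_)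
  change VectorMeasure.trim (a • μ.1 + b • ν.1) hm A =
    a • VectorMeasure.trim μ.1 hm A + b • VectorMeasure.trim ν.1 hm A
  rw [VectorMeasure.trim_measurableSet_eq hm hA, VectorMeasure.trim_measurableSet_eq hm hA,
    VectorMeasure.trim_measurableSet_eq hm hA]
  rfl

omit [IsFiniteMeasure P] in
lemma restrictTo_mem_restrictClosure (hm : m ≤ mΩ) {S : Set (SMeas (le_refl mΩ) P)}
    {μ : SMeas (le_refl mΩ) P} (hμ : μ ∈ S) : restrictTo hm μ ∈ restrictClosure hm S :=
  @subset_closure _ (weakTopology hm P) _ _ ⟨μ, hμ, rfl⟩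

/-- By the Hahn–Banach theorem, the weak closure of `𝒮^𝒢` is determined by the support function of
`𝒮` on `L^∞(𝒢)`. -/
lemma mem_restrictClosure_iff (hm : m ≤ mΩ) {S : Set (SMeas (le_refl mΩ) P)} (hS : Convex ℝ S)
    {ρ : LInf P → ℝ} (hρ : ∀ X, IsLUB ((fun μ => expect μ X) '' S) (ρ X)) (ν : SMeas hm P) :
    ν ∈ restrictClosure hm S ↔ ∀ X ∈ LInfSub m P, expect ν X ≤ ρ X := by
  constructor
  · intro hν X hX
    let _ := weakTopology hm P
    have hind : Continuous fun (μ : SMeas hm P) (X : LInfSub m P) => expect μ X.1 :=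
      continuous_induced_dom
    have hcont : Continuous fun μ : SMeas hm P => expect μ X :=
      (continuous_apply (⟨X, hX⟩ : LInfSub m P)).comp hind
    refine closure_minimal (t := {μ : SMeas hm P | expect μ X ≤ ρ X}) ?_
      (isClosed_le hcont continuous_const) hν
    rintro _ ⟨μ, hμ, rfl⟩
    exact (expect_restrictTo hm μ hX).trans_le ((hρ X).1 ⟨μ, hμ, rfl⟩)
  · intro h
    refine mem_closure_induced_of_forall_le (expectBilin hm P) (s := restrictTo hm '' S) ?_
      fun X c hc => ?_
    · rintro _ ⟨μ, hμ, rfl⟩ _ ⟨μ', hμ', rfl⟩ a b ha hb hab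
      exact ⟨_, hS hμ hμ' ha hb hab, restrictTo_add_smul hm μ μ' a b⟩
    · refine (h X.1 X.2).trans ((hρ X.1).2 ?_)
      rintro _ ⟨μ, hμ, rfl⟩
      exact (expect_restrictTo hm μ X.2).symm.trans_le (hc _ ⟨μ, hμ, rfl⟩)

end Closure

section Supremum

variable {Ω : Type*} {mΩ : MeasurableSpace Ω} {P : Measure Ω} [IsFiniteMeasure P]
  {S : Set (SMeas (le_refl mΩ) P)} {ρ : LInf P → ℝ}

lemma isCoherent_of_isLUB (hS : S ⊆ PMeas (le_refl mΩ) P)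
    (hρ : ∀ X, IsLUB ((fun μ => expect μ X) '' S) (ρ X)) : IsCoherent ρ := by
  have le : ∀ μ ∈ S, ∀ X, expect μ X ≤ ρ X := fun μ hμ X => (hρ X).1 ⟨μ, hμ, rfl⟩
  have ub : ∀ X b, (∀ μ ∈ S, expect μ X ≤ b) → ρ X ≤ b := fun X b h =>
    (hρ X).2 (by rintro _ ⟨μ, hμ, rfl⟩; exact h μ hμ)
  have smul_le : ∀ X (t : ℝ), 0 ≤ t → ρ (t • X) ≤ t * ρ X := fun X t ht =>
    ub _ _ fun μ hμ => by
      rw [expect_smul_right]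
      exact mul_le_mul_of_nonneg_left (le μ hμ X) ht
  refine ⟨fun X c => le_antisymm ?_ ?_, fun X Y hXY => ?_, fun X Y t ht ht1 => ?_,
    fun X t ht => le_antisymm (smul_le X t ht) ?_⟩
  · refine ub _ _ fun μ hμ => ?_
    rw [expect_add_right, expect_const (hS hμ)]
    linarith [le μ hμ X]
  · rw [← le_sub_iff_add_le]
    refine ub _ _ fun μ hμ => ?_
    have := le μ hμ (X + Lp.const ∞ P c)
    rw [expect_add_right, expect_const (hS hμ)] at this
    linarith
  · exact ub _ _ fun μ hμ => (expect_mono (hS hμ) hXY).trans (le μ hμ Y)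
  · refine ub _ _ fun μ hμ => ?_
    rw [expect_add_right, expect_smul_right, expect_smul_right]
    have := sub_nonneg.2 ht1
    gcongr
    exacts [le μ hμ X, le μ hμ Y]
  · rcases ht.eq_or_lt with rfl | ht
    · obtain ⟨_, μ, hμ, rfl⟩ := (hρ 0).nonempty
      have := le μ hμ ((0 : ℝ) • X)
      rw [expect_smul_right, zero_mul] at this
      rwa [zero_mul]
    · have := smul_le (t • X) t⁻¹ (inv_nonneg.2 ht.le)
      rwa [smul_smul, inv_mul_cancel₀ ht.ne', one_smul, inv_mul_eq_div, le_div_iff₀ ht,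
        mul_comm] at this

omit [IsFiniteMeasure P] in
lemma isFatou_of_isLUB (hρ : ∀ X, IsLUB ((fun μ => expect μ X) '' S) (ρ X)) : IsFatou ρ := by
  rintro X Xn ⟨C, hC⟩ hlim
  refine EReal.ge_of_forall_gt_iff_ge.1 fun c hc => ?_
  obtain ⟨_, ⟨μ, hμ, rfl⟩, hcμ, -⟩ := (hρ X).exists_between (EReal.coe_lt_coe_iff.1 hc)
  have hconv : Tendsto (fun n => expect μ (Xn n)) atTop (𝓝 (expect μ X)) := by
    refine tendsto_integral_of_dominated_convergence (fun ω => |density μ ω| * C)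
      (fun n => (integrable_density_mul μ (Xn n)).aestronglyMeasurable)
      ((integrable_density μ).abs.mul_const C) (fun n => ?_) ?_
    · filter_upwards [ae_abs_le_norm (Xn n)] with ω hω
      rw [norm_mul]
      exact mul_le_mul_of_nonneg_left (hω.trans (hC n)) (norm_nonneg _)
    · filter_upwards [hlim] with ω hω
      exact hω.const_mul _
  refine le_liminf_of_le (by isBoundedDefault) ?_
  filter_upwards [hconv.eventually_const_lt hcμ] with n hn
  exact EReal.coe_le_coe_iff.2 (hn.le.trans ((hρ (Xn n)).1 ⟨μ, hμ, rfl⟩))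

end Supremum

section LawInvariance

variable {Ω : Type*} {m mΩ : MeasurableSpace Ω} {P : Measure Ω} [IsFiniteMeasure P]
  {ρ : LInf P → ℝ}

/-- A copy of `D_ν` that is nearly as well aligned with `Y` as `D_ν` is with `X` is again a density in
the closure, hence `E^ν[X] ≤ ρ(Y)` up to `ε`. -/
lemma isLawInvariant_of_isLUB (hm : m ≤ mΩ) (hatom : Atomless m P)
    {S : Set (SMeas (le_refl mΩ) P)} (hconv : Convex ℝ S)
    (hS : IsLawInvariantSet m (densities (restrictClosure hm S)))
    (hρ : ∀ X, IsLUB ((fun μ => expect μ X) '' S) (ρ X)) : IsLawInvariant m ρ := by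
  have key : ∀ X ∈ LInfSub m P, ∀ Y ∈ LInfSub m P, IdentDistrib X Y P P → ρ X ≤ ρ Y := by
    intro X hX Y hY hXY
    refine (hρ X).2 ?_
    rintro _ ⟨μ, hμ, rfl⟩
    dsimp only
    rw [← expect_restrictTo hm μ hX]
    have hν := restrictTo_mem_restrictClosure hm hμ
    set ν := restrictTo hm μ
    refine le_of_forall_pos_le_add fun ε hε => ?_
    have hDm := stronglyMeasurable_density ν
    have hDi := integrable_density ν
    obtain ⟨D', hD'm, hD', hle⟩ := exists_rearrangement hm hatom
      (mem_lpMeas_iff_aestronglyMeasurable.1 hX) (mem_lpMeas_iff_aestronglyMeasurable.1 hY) hXY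
      hDm.aestronglyMeasurable hDi
      ((integrable_density_mul ν X).congr (ae_of_all _ fun ω => mul_comm _ _)) hε
    have e1 := AEEqFun.coeFn_mk (density ν) hDi.aestronglyMeasurable
    have hD'a : AEStronglyMeasurable D' P := (hD'm.mono hm).aestronglyMeasurable
    have e2 := AEEqFun.coeFn_mk D' hD'a
    obtain ⟨ν', hν', hD'ν⟩ := hS (AEEqFun.mk (density ν) hDi.aestronglyMeasurable)
      ⟨ν, hν, e1⟩ (hDm.aestronglyMeasurable.congr e1.symm)
      (AEEqFun.mk D' hD'a)
      (hD'm.aestronglyMeasurable.congr e2.symm)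
      (((IdentDistrib.of_ae_eq hDi.aemeasurable e1.symm).symm.trans hD').trans
        (IdentDistrib.of_ae_eq hD'a.aemeasurable e2.symm))
    have h1 := (mem_restrictClosure_iff hm hconv hρ ν').1 hν' Y hY
    have h2 : ∫ ω, Y ω * D' ω ∂P = expect ν' Y := by
      refine integral_congr_ae ?_
      filter_upwards [e2, hD'ν] with ω h3 h4
      rw [← h4, h3, mul_comm]
    have h3 : ∫ ω, X ω * density ν ω ∂P = expect ν X :=
      integral_congr_ae (ae_of_all _ fun ω => mul_comm _ _)
    linarith
  exact fun X hX Y hY hXY => le_antisymm (key X hX Y hY hXY) (key Y hY X hX hXY.symm)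

/-- If `Y` is a copy of `D_ν`, then each `Z ∈ L^∞(𝒢)` has a copy `Z'` with `E[Y Z] - ε ≤ E^ν[Z']`,
and `E^ν[Z'] ≤ ρ(Z') = ρ(Z)`. -/
lemma isLawInvariantSet_of_isLawInvariant (hm : m ≤ mΩ) (hatom : Atomless m P)
    (hlaw : IsLawInvariant m ρ) {S : Set (SMeas (le_refl mΩ) P)} (hconv : Convex ℝ S)
    (hρ : ∀ X, IsLUB ((fun μ => expect μ X) '' S) (ρ X)) :
    IsLawInvariantSet m (densities (restrictClosure hm S)) := by
  rintro D ⟨ν, hν, hDν⟩ hDm Y hYm hDY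
  have hDi : Integrable D P := (integrable_density ν).congr hDν.symm
  have hYi : Integrable Y P := hDY.integrable_iff.1 hDi
  obtain ⟨ν', hYν'⟩ := exists_density_eq hm hYi hYm
  refine ⟨ν', (mem_restrictClosure_iff hm hconv hρ ν').2 fun Z hZ => ?_, hYν'⟩
  refine le_of_forall_pos_le_add fun ε hε => ?_
  obtain ⟨Z', hZ'm, hZZ', hle⟩ := exists_rearrangement hm hatom hYm hDm hDY.symm
    (mem_lpMeas_iff_aestronglyMeasurable.1 hZ) (integrable_linf Z)
    (integrable_mul_of_integrable hYi Z) hε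
  have hZ'mem : MemLp Z' ∞ P := hZZ'.memLp_iff.1 (Lp.memLp Z)
  have e1 := hZ'mem.coeFn_toLp
  have hmem : hZ'mem.toLp Z' ∈ LInfSub m P :=
    mem_lpMeas_iff_aestronglyMeasurable.2 (hZ'm.aestronglyMeasurable.congr e1.symm)
  have h1 := (mem_restrictClosure_iff hm hconv hρ ν).1 hν _ hmem
  rw [← hlaw Z hZ _ hmem (hZZ'.trans
    (IdentDistrib.of_ae_eq (hZ'm.mono hm).measurable.aemeasurable e1.symm))] at h1
  have h2 : ∫ ω, Y ω * Z ω ∂P = expect ν' Z := by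
    refine integral_congr_ae ?_
    filter_upwards [hYν'] with ω h
    rw [h]
  have h3 : ∫ ω, D ω * Z' ω ∂P = expect ν (hZ'mem.toLp Z') := by
    refine integral_congr_ae ?_
    filter_upwards [hDν, e1] with ω h h'
    rw [h, h']
  linarith

end LawInvariance

end PartialLaw

theorem theorem1 {Ω : Type*} {m mΩ : MeasurableSpace Ω} (P : Measure Ω)
    [IsProbabilityMeasure P] (hm : m ≤ mΩ) (hatom : Atomless m P) (ρ : LInf P → ℝ) :
    List.TFAE
      [ IsFatou ρ ∧ IsLawInvariant m ρ ∧ IsCoherent ρ,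
        ∃ S : Set (SMeas (le_refl mΩ) P), S ⊆ PMeas (le_refl mΩ) P ∧ Convex ℝ S ∧
          IsLawInvariantSet m (densities (restrictClosure hm S)) ∧
          ∀ X : LInf P, IsLUB ((fun μ => expect μ X) '' S) (ρ X),
        IsFatou ρ ∧ IsCoherent ρ ∧
          IsLawInvariantSet m (densities (restrictClosure hm (supportingSet ρ))) ] := by
  tfae_have 1 → 3 := fun ⟨hF, hlaw, hρ⟩ => ⟨hF, hρ,
    isLawInvariantSet_of_isLawInvariant hm hatom hlaw (convex_supportingSet ρ)
      (isLUB_supportingSet hρ hF)⟩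
  tfae_have 3 → 2 := fun ⟨hF, hρ, hinv⟩ => ⟨supportingSet ρ, fun _ hμ => hμ.1,
    convex_supportingSet ρ, hinv, isLUB_supportingSet hρ hF⟩
  tfae_have 2 → 1 := fun ⟨_, hS, hconv, hinv, hρ⟩ => ⟨isFatou_of_isLUB hρ,
    isLawInvariant_of_isLUB hm hatom hconv hinv hρ, isCoherent_of_isLUB hS hρ⟩
  tfae_finish
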